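/- Let $\mathbb K$ be a field, $l\ge 1$, $\mathbf n=(n_1,\dots,n_l)$ with all $n_i\ge 1$, $n=n_1+\dots+n_l$, $1\le k\le n$, and assume $\operatorname{char}\mathbb K=0$ or $\operatorname{char}\mathbb K\ge\max_i n_i$. Put $m=\min\{k-1,n-k\}$ and let $1\le j\le m+1$. Let $Z\subset\mathbb K^l$ be the set of $u=(u_1,\dots,u_l)$ with $u_i=u_{i'}$ for some $i\ne i'$, and write $v=(v_{i,s})_{1\le i\le l,\,0\le s<n_i}\in\mathbb K^n$. For $(u,v)\in(\mathbb K^l\setminus Z)\times\mathbb K^n$ consider the weak Hermite interpolation problem: find $A,B\in\mathbb K[x]$ with $\deg A\le k-1$, $\deg B\le n-k$ and $$A^{(s)}(u_i)=\sum_{t=0}^{s}s(s-1)\cdots(s-t+1)\,v_{i,t}\,B^{(s-t)}(u_i),\qquad 1\le i\le l,\ 0\le s<n_i .$$ A minimal solution is a nonzero solution $(A,B)$ with $\deg A$ as small as possible (where $\deg 0=-\infty$) and, among these, $\deg B$ as small as possible; it exists and is unique up to a nonzero constant. For $0\le a\le n+1$ let $M_a(u,v)$ be the $n\times(n+1)$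 matrix with rows indexed lexicographically by the pairs $(i,s)$, whose first $a$ columns have entries $\binom{c}{s}u_i^{c-s}$ ($0\le c<a$) and whose last $n+1-a$ columns have entries $-\sum_{t=0}^{s}\binom{d}{t}v_{i,s-t}u_i^{d-t}$ ($0\le d\le n-a$), terms with zero binomial coefficient being $0$. Let $\Delta_{a,i}$ be $(-1)^i$ times the minor of $M_a$ obtained by deleting the $i$-th column, regarded as a polynomial in indeterminates $U_i,V_{i,s}$. Put $M_{u,v,n,k}=M_k(u,v)$. 1. For every $(u,v)\in(\mathbb K^l\setminus Z)\times\mathbb K^n$, the minimal solution $(A,B)$ satisfies $\deg A\le k-j$ and $\deg B\le n-k+1-j$ if and only if $\dim\ker M_{u,v,n,k}\ge j$. Moreover $\dim\ker M_{u,v,n,k}=j$ if and only if these two bounds hold and at least one of them is an equality. 2. For every such $(u,v)$, $\dim\ker M_{u,v,n,k}\ge j$ if and only if $$\Delta_{k-j+2,k-j+2}=\Delta_{k-j+3,k-j+3}=\dots=\Delta_{k+j-1,k+j-1}=0\quad\text{at }(u,v)\qquad(*)$$ (no condition if $j=1$), and $\dim\ker M_{u,v,n,k}=j$ if and only if $(*)$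 holds and in addition $\Delta_{k-j+1,k-j+1}\ne0$ or $\Delta_{k+j,k+j}\ne 0$ at $(u,v)$. 3. If $(u,v)$ satisfies $(*)$, then a minimal solution is given, with all minors evaluated at $(u,v)$, by $$\Big(\sum_{\ell=0}^{k-j}\Delta_{k-j+1,\ell+1}x^\ell,\ \sum_{\ell=k-j+1}^{n-2j+2}\Delta_{k-j+1,\ell+1}x^{\ell-k+j-1}\Big)\quad\text{if }\Delta_{k-j+1,k-j+1}\ne0,$$ $$\Big(\sum_{\ell=0}^{k-j}\Delta_{k+j-1,\ell+1}x^\ell,\ \sum_{\ell=k+j-1}^{n}\Delta_{k+j-1,\ell+1}x^{\ell-k-j+1}\Big)\quad\text{if }\Delta_{k+j,k+j}\ne0.$$ 4. If $\mathbb K$ is algebraically closed, the locus of the $(u,v)\in(\mathbb K^l\setminus Z)\times\mathbb K^n$ satisfying $(*)$ is irreducible and rational (its function field is purely transcendental over $\mathbb K$), has codimension $2(j-1)$, and is a complete intersection, in the sense that its codimension equals the number $2(j-1)$ of equations in $(*)$ that cut it out. -/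

import Mathlib

namespace HermiteInterpolation

open Polynomial

section Matrices

variable {R : Type*} [CommRing R] {l : ℕ} {n : Fin l → ℕ}

/-- The matrix `M_{α,β,n}(u,v)` with `a = α + 1` columns for the coefficients of the numerator `A`
and `w - a = β + 1` columns for those of the denominator `B`. The rows are indexed by pairs `(i, s)`
with `0 ≤ s < n i`; the columns are counted from `0`. The entry in row `(i, s)` is
`C(c, s) u_i ^ (c - s)` in the numerator column of `x ^ c`, and
`- ∑_{t ≤ s} C(d, t) v_{i, s - t} u_i ^ (d - t)` in the denominator column of `x ^ d`
(the binomial coefficients are `0` where the exponents would be negative). -/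
def hermiteMatrix (u : Fin l → R) (v : (i : Fin l) → Fin (n i) → R) (a w : ℕ) :
    Matrix (Σ i, Fin (n i)) (Fin w) R :=
  Matrix.of fun r c =>
    if (c : ℕ) < a then
      (Nat.choose c r.2 : R) * u r.1 ^ ((c : ℕ) - r.2)
    else
      -∑ t : Fin ((r.2 : ℕ) + 1),
        (Nat.choose ((c : ℕ) - a) t : R)
          * v r.1 ⟨(r.2 : ℕ) - t, lt_of_le_of_lt (Nat.sub_le _ _) r.2.isLt⟩
          * u r.1 ^ ((c : ℕ) - a - t)

/-- The signed `i`-th maximal minor (`1 ≤ i ≤ N + 1`, where `N = ∑ i, n i`) of the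
`N × (N + 1)` matrix with `a` numerator columns and `N + 1 - a` denominator columns:
`(-1) ^ i` times the determinant left after deleting the `i`-th column. The rows are ordered
lexicographically. -/
def signedMinor (u : Fin l → R) (v : (i : Fin l) → Fin (n i) → R) (a i : ℕ) : R :=
  (-1) ^ i *
    ((hermiteMatrix u v a ((∑ i, n i) + 1)).submatrix finSigmaFinEquiv.symm
      (Fin.succAbove (Fin.ofNat ((∑ i, n i) + 1) (i - 1)))).det

end Matrices

section Parameters

/-- The indices of the indeterminates `U_i` and `V_{i,s}`. -/
abbrev Params {l : ℕ} (n : Fin l → ℕ) : Type := Fin l ⊕ (Σ i, Fin (n i))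

/-- The polynomial `Δ_{a,i}` in the indeterminates `U, V`: the signed `i`-th maximal minor of the
generic matrix with `a` numerator columns and `N + 1 - a` denominator columns. -/
noncomputable def Delta (K : Type*) [CommRing K] {l : ℕ} (n : Fin l → ℕ) (a i : ℕ) :
    MvPolynomial (Params n) K :=
  signedMinor (n := n) (fun i => MvPolynomial.X (Sum.inl i))
    (fun i s => MvPolynomial.X (Sum.inr ⟨i, s⟩)) a i

variable {K : Type*} {l : ℕ} {n : Fin l → ℕ}

/-- The data `(u, v)` as a point of the affine space `K^l × K^N`. -/
def dataPoint (u : Fin l → K) (v : (i : Fin l) → Fin (n i) → K) : Params n → K :=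
  Sum.elim u (fun s => v s.1 s.2)

/-- The space `(K^l ∖ Z) × K^N` of data with pairwise distinct nodes `u_1, …, u_l`. -/
def dataSpace (K : Type*) {l : ℕ} (n : Fin l → ℕ) : Set (Params n → K) :=
  {p | Function.Injective fun i => p (Sum.inl i)}

end Parameters

section Problem

variable {K : Type*} [Field K] {l : ℕ} {n : Fin l → ℕ}

/-- `(A, B)` solves the weak Hermite interpolation problem for the data `(u, v)`, with the degree
bounds `k - 1` and `N - k` (used for `1 ≤ k ≤ N = ∑ i, n i`). -/
structure IsWeakSolution (u : Fin l → K) (v : (i : Fin l) → Fin (n i) → K) (k : ℕ)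
    (A B : K[X]) : Prop where
  degree_num : A.degree ≤ ((k - 1 : ℕ) : WithBot ℕ)
  degree_den : B.degree ≤ (((∑ i, n i) - k : ℕ) : WithBot ℕ)
  interp : ∀ (i : Fin l) (s : Fin (n i)),
    (derivative^[(s : ℕ)] A).eval (u i) =
      ∑ t : Fin ((s : ℕ) + 1),
        (Nat.descFactorial s t : K)
          * v i ⟨t, lt_of_le_of_lt (Nat.le_of_lt_succ t.isLt) s.isLt⟩
          * (derivative^[(s : ℕ) - t] B).eval (u i)

/-- A minimal solution: a nonzero solution whose first component has the least possible degree
among all nonzero solutions (`deg 0 = -∞`) and, among those, whose second component has the least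
possible degree. The last clause only matters when the first component vanishes. -/
structure IsMinimalSolution (u : Fin l → K) (v : (i : Fin l) → Fin (n i) → K) (k : ℕ)
    (A B : K[X]) : Prop where
  isSolution : IsWeakSolution u v k A B
  ne_zero : (A, B) ≠ (0, 0)
  degree_num_le : ∀ A' B' : K[X], IsWeakSolution u v k A' B' → (A', B') ≠ (0, 0) →
    A.degree ≤ A'.degree
  degree_den_le : ∀ A' B' : K[X], IsWeakSolution u v k A' B' → (A', B') ≠ (0, 0) →
    A'.degree = A.degree → B.degree ≤ B'.degree

end Problem

section Geometry

variable {K : Type*} [Field K] {σ : Type*}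

/-- The subset `X` of affine space is (Zariski-)irreducible: its vanishing ideal is prime. (In
particular `X` is not empty.) -/
def IsIrreducibleLocus (X : Set (σ → K)) : Prop :=
  (MvPolynomial.vanishingIdeal K X).IsPrime

/-- The codimension in affine space of the Zariski closure of `X`: the height of its vanishing
ideal. For `X` inside a Zariski-open set it is also the codimension of `X` in that set. -/
noncomputable def codim (X : Set (σ → K)) : ℕ∞ :=
  (MvPolynomial.vanishingIdeal K X).height

/-- Rationality of an irreducible locus: its function field, the field of fractions of
`K[σ] / I(X)`, is purely transcendental over `K`, of finite transcendence degree. -/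
def IsRationalLocus (X : Set (σ → K)) : Prop :=
  ∃ d : ℕ, Nonempty
    (FractionRing (MvPolynomial σ K ⧸ MvPolynomial.vanishingIdeal K X) ≃ₐ[K]
      FractionRing (MvPolynomial (Fin d) K))

/-- The common zeros in `Y` of the finite family `(f a)_{a ∈ S}`. -/
def zerosIn {ι : Type*} (Y : Set (σ → K)) (S : Finset ι) (f : ι → MvPolynomial σ K) :
    Set (σ → K) :=
  {p | p ∈ Y ∧ ∀ a ∈ S, MvPolynomial.eval p (f a) = 0}

/-- The equations `f a = 0`, `a ∈ S`, define a complete intersection in the open set `Y`: the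
codimension of their locus is the number of equations. -/
def IsCompleteIntersection {ι : Type*} (Y : Set (σ → K)) (S : Finset ι)
    (f : ι → MvPolynomial σ K) : Prop :=
  codim (zerosIn Y S f) = S.card

end Geometry

end HermiteInterpolation

/-! Write `N = ∑ i, n i` and let `f_i` be the polynomial with Taylor coefficients `v i s` at `u i`.
Once the factorials are cancelled, the weak problem says `A ≡ f_i B` modulo `(X - u_i)^(n_i)` for
all `i`, and a kernel vector of the matrix with `a` numerator columns is a pair of this kind with
`deg A < a` and `deg B < N + 1 - a`.

Everything algebraic rests on one remark (`cross_eq_of_mem_solutions`): for two solutions, `A B' -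
A' B` is divisible by `∏ (X - u_i)^(n_i)`, of degree `N`, so it vanishes when the degree bounds are
complementary. By Euclidean division all solutions are then polynomial multiples `q g` of one
generator `g` (`exists_isGenerator`). The minimal solution is `g`, and the kernel has dimension at
least `j` exactly when `X^(j-1) g` respects the bounds. The minor `Δ_{a+1,a+1}` vanishes iff some
nonzero solution has bounds `(a, N - a)`; such a solution is a multiple of `g`, so each vanishing
minor lowers one degree bound of `g` (`mem_solutions_succ_iff`), and induction gives the equations.
The signed minors themselves form a kernel vector, proportional to `g` whenever the solution space
is a line.

For the geometry put `α = k - j`, `β = N + 1 - k - j`. Take independent nodes, a numerator of degree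
`α` and a monic denominator of degree `β` with independent coefficients, and the Taylor coefficients
of their quotient. This generic point has `l + (α + 1) + β = l + N - 2 (j - 1)` parameters, and they
are rational functions of its coordinates because the generic pair is coprime (`adjoin_eq_top`),
whence rationality. Let `P` be its ideal. A minimal prime `q` over the `2 (j - 1)` equations has
height at most `2 (j - 1)` by Krull. If no two nodes coincide modulo `q`, the residue field of `q`
carries a pair `(A, B)` with `B` monic. Were `deg B < β` or `B` zero at a node, too few elements
would generate that field and the height would be too large (`Interpolates.exists_generators_lt`);
otherwise `q` is a specialisation of the generic point and `P ≤ q` (`ker_le_of_mem_minimalPrimes`).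
So `P` is the only component off the diagonals, and its height is `2 (j - 1)`. -/

namespace HermiteInterpolation

open Polynomial

/-! ### Kernel vectors as pairs of interpolating polynomials -/

section Bridge

variable {R : Type*} [CommRing R] {l : ℕ} {n : Fin l → ℕ}

/-- The polynomial with Taylor coefficients `v i s` at the node `u i`. -/
noncomputable def localInterpolant (u : Fin l → R) (v : (i : Fin l) → Fin (n i) → R)
    (i : Fin l) : R[X] :=
  ∑ s : Fin (n i), C (v i s) * (X - C (u i)) ^ (s : ℕ)

/-- The interpolation conditions, as congruences at each node. -/
def Interpolates (u : Fin l → R) (v : (i : Fin l) → Fin (n i) → R) (A B : R[X]) : Prop :=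
  ∀ i, (X - C (u i)) ^ n i ∣ A - localInterpolant u v i * B

theorem X_sub_C_pow_dvd_iff_taylor (r : R) (m : ℕ) (f : R[X]) :
    (X - C r) ^ m ∣ f ↔ ∀ s < m, (taylor r f).coeff s = 0 := by
  rw [← X_pow_dvd_iff, ← map_dvd_iff (taylorEquiv r)]
  simp [taylorEquiv]

theorem taylor_localInterpolant_coeff (u : Fin l → R) (v : (i : Fin l) → Fin (n i) → R)
    (i : Fin l) (s : Fin (n i)) : (taylor (u i) (localInterpolant u v i)).coeff s = v i s := by
  simp only [localInterpolant, map_sum, taylor_mul, taylor_C, taylor_pow, map_sub, taylor_X,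
    add_sub_cancel_right, finsetSum_coeff, coeff_C_mul, coeff_X_pow]
  rw [Finset.sum_eq_single s]
  · simp
  · intro b _ hb
    simp [Fin.val_ne_of_ne hb.symm]
  · simp

/-- The defect of the interpolation condition in row `r`. -/
noncomputable def defect (u : Fin l → R) (v : (i : Fin l) → Fin (n i) → R)
    (r : Σ i, Fin (n i)) : R[X] × R[X] →ₗ[R] R :=
  lcoeff R (r.2 : ℕ) ∘ₗ taylor (u r.1) ∘ₗ LinearMap.fst R _ _ -
    ∑ t : Fin ((r.2 : ℕ) + 1), v r.1 ⟨(r.2 : ℕ) - t, lt_of_le_of_lt (Nat.sub_le _ _) r.2.isLt⟩ •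
      (lcoeff R (t : ℕ) ∘ₗ taylor (u r.1) ∘ₗ LinearMap.snd R _ _)

theorem defect_apply (u : Fin l → R) (v : (i : Fin l) → Fin (n i) → R)
    (r : Σ i, Fin (n i)) (A B : R[X]) :
    defect u v r (A, B) = (taylor (u r.1) A).coeff r.2 -
      ∑ t : Fin ((r.2 : ℕ) + 1), v r.1 ⟨(r.2 : ℕ) - t, lt_of_le_of_lt (Nat.sub_le _ _) r.2.isLt⟩ *
        (taylor (u r.1) B).coeff t := by
  simp [defect]

/-- Taylor expansion at the node turns the product into a Cauchy product. Only coefficients of index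
at most `r.2 < n r.1` enter, and there the local interpolant has coefficients `v`. -/
theorem defect_eq_coeff (u : Fin l → R) (v : (i : Fin l) → Fin (n i) → R)
    (r : Σ i, Fin (n i)) (A B : R[X]) :
    defect u v r (A, B) = (taylor (u r.1) (A - localInterpolant u v r.1 * B)).coeff r.2 := by
  rw [defect_apply, map_sub, coeff_sub, mul_comm, taylor_mul, coeff_mul,
    Finset.Nat.sum_antidiagonal_eq_sum_range_succ_mk, Finset.sum_range]
  congr 1
  refine Finset.sum_congr rfl fun t _ => ?_
  rw [mul_comm]
  congr 1
  exact (taylor_localInterpolant_coeff u v r.1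
    ⟨(r.2 : ℕ) - t, lt_of_le_of_lt (Nat.sub_le _ _) r.2.isLt⟩).symm

theorem interpolates_iff_defect (u : Fin l → R) (v : (i : Fin l) → Fin (n i) → R) (A B : R[X]) :
    Interpolates u v A B ↔ ∀ r, defect u v r (A, B) = 0 := by
  simp only [Interpolates, X_sub_C_pow_dvd_iff_taylor, defect_eq_coeff]
  exact ⟨fun h r => h r.1 r.2 r.2.isLt, fun h i s hs => h ⟨i, s, hs⟩⟩

/-- The pair of polynomials with the given coefficients: the first `a` for the numerator, the
other ones for the denominator. -/
noncomputable def toPair (R : Type*) [CommRing R] (a w : ℕ) : (Fin w → R) →ₗ[R] R[X] × R[X] :=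
  Fintype.linearCombination R fun j : Fin w =>
    if (j : ℕ) < a then ((X : R[X]) ^ (j : ℕ), (0 : R[X])) else (0, X ^ ((j : ℕ) - a))

theorem toPair_fst (a w : ℕ) (c : Fin w → R) :
    (toPair R a w c).1 = ∑ j : Fin w, if (j : ℕ) < a then C (c j) * X ^ (j : ℕ) else 0 := by
  rw [toPair, Fintype.linearCombination_apply, Prod.fst_sum]
  refine Finset.sum_congr rfl fun j _ => ?_
  split_ifs <;> simp [smul_eq_C_mul]

theorem toPair_snd (a w : ℕ) (c : Fin w → R) :
    (toPair R a w c).2 = ∑ j : Fin w, if (j : ℕ) < a then 0 else C (c j) * X ^ ((j : ℕ) - a) := by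
  rw [toPair, Fintype.linearCombination_apply, Prod.snd_sum]
  refine Finset.sum_congr rfl fun j _ => ?_
  split_ifs <;> simp [smul_eq_C_mul]

theorem toPair_fst_coeff {a w : ℕ} (c : Fin w → R) (j : Fin w) (hj : (j : ℕ) < a) :
    (toPair R a w c).1.coeff j = c j := by
  rw [toPair_fst, finsetSum_coeff, Finset.sum_eq_single j]
  · simp [hj]
  · intro b _ hb
    split_ifs
    · simp [coeff_X_pow, Fin.val_ne_of_ne hb.symm]
    · simp
  · simp

theorem toPair_snd_coeff {a w : ℕ} (c : Fin w → R) (j : Fin w) (hj : a ≤ (j : ℕ)) :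
    (toPair R a w c).2.coeff ((j : ℕ) - a) = c j := by
  rw [toPair_snd, finsetSum_coeff, Finset.sum_eq_single j]
  · simp [hj.not_gt]
  · intro b _ hb
    have := Fin.val_ne_of_ne hb
    split_ifs with h
    · simp
    · rw [coeff_C_mul, coeff_X_pow, if_neg (by omega), mul_zero]
  · simp

theorem toPair_injective (a w : ℕ) : Function.Injective (toPair R a w) := by
  intro c c' h
  funext j
  rcases lt_or_ge (j : ℕ) a with hj | hj
  · rw [← toPair_fst_coeff c j hj, h, toPair_fst_coeff c' j hj]
  · rw [← toPair_snd_coeff c j hj, h, toPair_snd_coeff c' j hj]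

theorem toPair_fst_mem (a w : ℕ) (c : Fin w → R) : (toPair R a w c).1 ∈ degreeLT R a := by
  rw [toPair_fst]
  refine Submodule.sum_mem _ fun j _ => ?_
  split_ifs with h
  · rw [mem_degreeLT]
    exact (degree_C_mul_X_pow_le _ _).trans_lt (by exact_mod_cast h)
  · exact zero_mem _

theorem toPair_snd_mem (a w : ℕ) (c : Fin w → R) : (toPair R a w c).2 ∈ degreeLT R (w - a) := by
  rw [toPair_snd]
  refine Submodule.sum_mem _ fun j _ => ?_
  split_ifs with h
  · exact zero_mem _
  · rw [mem_degreeLT]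
    refine (degree_C_mul_X_pow_le _ _).trans_lt ?_
    have := j.isLt
    exact_mod_cast (by omega : (j : ℕ) - a < w - a)

theorem exists_toPair_eq {a w : ℕ} (ha : a ≤ w) {A B : R[X]} (hA : A ∈ degreeLT R a)
    (hB : B ∈ degreeLT R (w - a)) : ∃ c, toPair R a w c = (A, B) := by
  rw [mem_degreeLT] at hA hB
  let c : Fin w → R := fun j => if (j : ℕ) < a then A.coeff j else B.coeff ((j : ℕ) - a)
  refine ⟨c, Prod.ext ?_ ?_⟩
  · ext m
    rcases lt_or_ge m a with hm | hm
    · have := toPair_fst_coeff c ⟨m, hm.trans_le ha⟩ hm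
      simpa [c, hm] using this
    · rw [coeff_eq_zero_of_degree_lt (hA.trans_le (by exact_mod_cast hm)),
        coeff_eq_zero_of_degree_lt ((mem_degreeLT.1 (toPair_fst_mem a w c)).trans_le
          (by exact_mod_cast hm))]
  · ext m
    rcases lt_or_ge m (w - a) with hm | hm
    · have := toPair_snd_coeff (a := a) c ⟨a + m, by omega⟩ (by simp)
      simpa [c] using this
    · rw [coeff_eq_zero_of_degree_lt (hB.trans_le (by exact_mod_cast hm)),
        coeff_eq_zero_of_degree_lt ((mem_degreeLT.1 (toPair_snd_mem a w c)).trans_le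
          (by exact_mod_cast hm))]

theorem taylor_X_pow_coeff (r : R) (m s : ℕ) :
    (taylor r (X ^ m : R[X])).coeff s = (Nat.choose m s : R) * r ^ (m - s) := by
  rw [taylor_X_pow, coeff_X_add_C_pow, mul_comm]

/-- Both sides are linear in `c`; the columns of the matrix are the defects of the monomials. -/
theorem hermiteMatrix_mulVec (u : Fin l → R) (v : (i : Fin l) → Fin (n i) → R) (a w : ℕ)
    (c : Fin w → R) (r : Σ i, Fin (n i)) :
    (hermiteMatrix u v a w).mulVec c r = defect u v r (toPair R a w c) := by
  rw [toPair, Fintype.linearCombination_apply, map_sum, Matrix.mulVec, dotProduct]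
  refine Finset.sum_congr rfl fun j _ => ?_
  rw [map_smul, smul_eq_mul, mul_comm]
  congr 1
  rw [hermiteMatrix, Matrix.of_apply]
  split_ifs with h
  · rw [defect_apply]
    simp only [taylor_X_pow_coeff, map_zero, coeff_zero, mul_zero, Finset.sum_const_zero, sub_zero]
  · rw [defect_apply]
    simp only [map_zero, coeff_zero, zero_sub, taylor_X_pow_coeff, neg_inj]
    exact Finset.sum_congr rfl fun t _ => by ring

theorem hermiteMatrix_mulVec_eq_zero_iff (u : Fin l → R) (v : (i : Fin l) → Fin (n i) → R)
    (a w : ℕ) (c : Fin w → R) :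
    (hermiteMatrix u v a w).mulVec c = 0 ↔
      Interpolates u v (toPair R a w c).1 (toPair R a w c).2 := by
  rw [interpolates_iff_defect, funext_iff]
  simp only [hermiteMatrix_mulVec, Pi.zero_apply]

theorem map_defect {S : Type*} [CommRing S] (f : R →+* S) (u : Fin l → R)
    (v : (i : Fin l) → Fin (n i) → R) (A B : R[X]) (r : Σ i, Fin (n i)) :
    defect (fun i => f (u i)) (fun i s => f (v i s)) r (A.map f, B.map f) =
      f (defect u v r (A, B)) := by
  simp only [defect_apply, map_sub, map_sum, map_mul, ← map_taylor, coeff_map]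

theorem Interpolates.map {S : Type*} [CommRing S] (f : R →+* S) {u : Fin l → R}
    {v : (i : Fin l) → Fin (n i) → R} {A B : R[X]} (h : Interpolates u v A B) :
    Interpolates (fun i => f (u i)) (fun i s => f (v i s)) (A.map f) (B.map f) := by
  rw [interpolates_iff_defect] at h ⊢
  intro r
  rw [map_defect, h r, map_zero]

/-- The module of pairs satisfying the interpolation conditions. -/
def interpolatesSubmodule (u : Fin l → R) (v : (i : Fin l) → Fin (n i) → R) :
    Submodule R[X] (R[X] × R[X]) where
  carrier := {p | Interpolates u v p.1 p.2}
  add_mem' {p q} hp hq i := by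
    have := dvd_add (hp i) (hq i)
    convert this using 1
    simp only [Prod.fst_add, Prod.snd_add]
    ring
  zero_mem' i := by simp
  smul_mem' c p hp i := by
    have := (hp i).mul_left c
    convert this using 1
    simp only [Prod.smul_fst, Prod.smul_snd, smul_eq_mul]
    ring

theorem mem_interpolatesSubmodule {u : Fin l → R} {v : (i : Fin l) → Fin (n i) → R}
    {p : R[X] × R[X]} : p ∈ interpolatesSubmodule u v ↔ Interpolates u v p.1 p.2 := Iff.rfl

/-- The solutions with numerator of degree `< a` and denominator of degree `< b`. -/
noncomputable def solutions (u : Fin l → R) (v : (i : Fin l) → Fin (n i) → R) (a b : ℕ) :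
    Submodule R (R[X] × R[X]) :=
  (degreeLT R a).prod (degreeLT R b) ⊓ (interpolatesSubmodule u v).restrictScalars R

theorem mem_solutions {u : Fin l → R} {v : (i : Fin l) → Fin (n i) → R} {a b : ℕ}
    {p : R[X] × R[X]} : p ∈ solutions u v a b ↔
      p.1.degree < a ∧ p.2.degree < b ∧ Interpolates u v p.1 p.2 := by
  simp [solutions, Submodule.mem_prod, mem_degreeLT, mem_interpolatesSubmodule, and_assoc]

theorem map_ker_hermiteMatrix (u : Fin l → R) (v : (i : Fin l) → Fin (n i) → R) {a w : ℕ}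
    (ha : a ≤ w) : (LinearMap.ker (hermiteMatrix u v a w).mulVecLin).map (toPair R a w) =
      solutions u v a (w - a) := by
  ext ⟨A, B⟩
  rw [Submodule.mem_map, mem_solutions]
  constructor
  · rintro ⟨c, hc, h⟩
    rw [LinearMap.mem_ker, Matrix.mulVecLin_apply, hermiteMatrix_mulVec_eq_zero_iff, h] at hc
    refine ⟨?_, ?_, hc⟩
    · rw [← h]; exact mem_degreeLT.1 (toPair_fst_mem a w c)
    · rw [← h]; exact mem_degreeLT.1 (toPair_snd_mem a w c)
  · rintro ⟨hA, hB, h⟩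
    obtain ⟨c, hc⟩ := exists_toPair_eq ha (mem_degreeLT.2 hA) (mem_degreeLT.2 hB)
    refine ⟨c, ?_, hc⟩
    rw [LinearMap.mem_ker, Matrix.mulVecLin_apply, hermiteMatrix_mulVec_eq_zero_iff, hc]
    exact h

theorem finrank_ker_hermiteMatrix (u : Fin l → R) (v : (i : Fin l) → Fin (n i) → R) {a w : ℕ}
    (ha : a ≤ w) : Module.finrank R (LinearMap.ker (hermiteMatrix u v a w).mulVecLin) =
      Module.finrank R (solutions u v a (w - a)) := by
  rw [← map_ker_hermiteMatrix u v ha]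
  exact (Submodule.equivMapOfInjective _ (toPair_injective a w) _).finrank_eq

theorem map_hermiteMatrix {S : Type*} [CommRing S] (f : R →+* S) (u : Fin l → R)
    (v : (i : Fin l) → Fin (n i) → R) (a w : ℕ) :
    (hermiteMatrix u v a w).map f =
      hermiteMatrix (fun i => f (u i)) (fun i s => f (v i s)) a w := by
  ext r c
  simp only [hermiteMatrix, Matrix.map_apply, Matrix.of_apply]
  split_ifs <;> simp

theorem map_signedMinor {S : Type*} [CommRing S] (f : R →+* S) (u : Fin l → R)
    (v : (i : Fin l) → Fin (n i) → R) (a i : ℕ) :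
    f (signedMinor u v a i) = signedMinor (fun i => f (u i)) (fun i s => f (v i s)) a i := by
  rw [signedMinor, signedMinor, map_mul, map_pow, map_neg, map_one, RingHom.map_det,
    RingHom.mapMatrix_apply, ← map_hermiteMatrix f u v]
  rfl

theorem eval_Delta (u : Fin l → R) (v : (i : Fin l) → Fin (n i) → R) (a i : ℕ) :
    MvPolynomial.eval (dataPoint u v) (Delta R n a i) = signedMinor u v a i := by
  rw [Delta, map_signedMinor]
  simp [dataPoint]

theorem aeval_Delta {S : Type*} [CommRing S] [Algebra R S] (x : Params n → S) (a i : ℕ) :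
    MvPolynomial.aeval x (Delta R n a i) =
      signedMinor (fun i => x (Sum.inl i)) (fun i s => x (Sum.inr ⟨i, s⟩)) a i := by
  rw [Delta]
  refine (map_signedMinor
    (MvPolynomial.aeval (R := R) x : MvPolynomial (Params n) R →ₐ[R] S).toRingHom _ _ a i).trans ?_
  simp

end Bridge

/-! ### Derivative conditions versus Taylor coefficients -/

section WeakSolution

theorem degree_le_iff_degree_lt {R : Type*} [Semiring R] {f : R[X]} {m m' : ℕ} (h : m' = m + 1) :
    f.degree ≤ (m : WithBot ℕ) ↔ f.degree < (m' : WithBot ℕ) := by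
  subst h
  rw [degree_le_iff_coeff_zero, degree_lt_iff_coeff_zero]
  exact ⟨fun h j hj => h j (by exact_mod_cast hj), fun h j hj => h j (by exact_mod_cast hj)⟩

variable {K : Type*} [Field K] {l : ℕ} {n : Fin l → ℕ}

theorem iterate_derivative_eval (A : K[X]) (s : ℕ) (r : K) :
    (derivative^[s] A).eval r = (s.factorial : K) * (taylor r A).coeff s := by
  rw [taylor_coeff, ← factorial_smul_hasseDeriv]
  simp

theorem factorial_ne_zero_of_ringChar {m s : ℕ} (hchar : ringChar K = 0 ∨ m ≤ ringChar K)
    (hs : s < m) : (s.factorial : K) ≠ 0 := by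
  intro h
  rw [ringChar.spec] at h
  rcases hchar with h0 | h0
  · rw [h0, zero_dvd_iff] at h
    exact Nat.factorial_ne_zero s h
  · rcases CharP.char_is_prime_or_zero K (ringChar K) with hp | hp
    · have := (hp.dvd_factorial).1 h
      omega
    · omega

/-- Condition `(i, s)` of the weak problem is `s!` times the defect in that row, and `s!` is
invertible because `s < n i`. This is where the characteristic enters. -/
theorem isWeakSolution_iff (hchar : ringChar K = 0 ∨ ∀ i, n i ≤ ringChar K)
    (u : Fin l → K) (v : (i : Fin l) → Fin (n i) → K) {k : ℕ} (hk : 1 ≤ k)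
    (hkN : k ≤ ∑ i, n i) (A B : K[X]) :
    IsWeakSolution u v k A B ↔ (A, B) ∈ solutions u v k (∑ i, n i + 1 - k) := by
  have key : (∀ (i : Fin l) (s : Fin (n i)), (derivative^[(s : ℕ)] A).eval (u i) =
      ∑ t : Fin ((s : ℕ) + 1), (Nat.descFactorial s t : K)
          * v i ⟨t, lt_of_le_of_lt (Nat.le_of_lt_succ t.isLt) s.isLt⟩
          * (derivative^[(s : ℕ) - t] B).eval (u i)) ↔ Interpolates u v A B := by
    rw [interpolates_iff_defect]
    refine ⟨fun h r => ?_, fun h i s => ?_⟩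
    all_goals
      first
      | (have hr := h r.1 r.2; obtain ⟨i, s⟩ := r; dsimp only at hr)
      | (have hr := h ⟨i, s⟩)
      have hf : ((s : ℕ).factorial : K) ≠ 0 :=
        factorial_ne_zero_of_ringChar (hchar.imp_right fun h => h i) s.isLt
      -- Reversing the sum matches the two index conventions; the constant comes from `(s - t)! *
      -- s.descFactorial t = s!`.
      have hsum : ∑ t : Fin ((s : ℕ) + 1), (Nat.descFactorial s t : K)
          * v i ⟨t, lt_of_le_of_lt (Nat.le_of_lt_succ t.isLt) s.isLt⟩
          * (derivative^[(s : ℕ) - t] B).eval (u i) = ((s : ℕ).factorial : K) *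
          ∑ t : Fin ((s : ℕ) + 1), v i ⟨(s : ℕ) - t, lt_of_le_of_lt (Nat.sub_le _ _) s.isLt⟩ *
            (taylor (u i) B).coeff t := by
        rw [Finset.mul_sum, ← Equiv.sum_comp Fin.revPerm]
        refine Finset.sum_congr rfl fun t _ => ?_
        have ht : (t : ℕ) ≤ s := Nat.le_of_lt_succ t.isLt
        have hrev : ((Fin.revPerm t : Fin ((s : ℕ) + 1)) : ℕ) = s - t := by
          simp [Fin.val_rev]
        have hv : ∀ (m m' : ℕ) (hm : m < n i) (hm' : m' < n i), m = m' →
            v i ⟨m, hm⟩ = v i ⟨m', hm'⟩ := by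
          intro m m' _ _ h; subst h; rfl
        rw [iterate_derivative_eval, hv _ ((s : ℕ) - t) _ (by omega) hrev, hrev,
          Nat.sub_sub_self ht, ← Nat.factorial_mul_descFactorial (Nat.sub_le (s : ℕ) t),
          Nat.sub_sub_self ht]
        push_cast
        ring
    · rw [hsum, iterate_derivative_eval] at hr
      rw [defect_apply, sub_eq_zero]
      exact mul_left_cancel₀ hf hr
    · rw [defect_apply, sub_eq_zero] at hr
      rw [hsum, iterate_derivative_eval, hr]
  rw [mem_solutions, ← key, ← degree_le_iff_degree_lt (m := k - 1) (by omega),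
    ← degree_le_iff_degree_lt (m := ∑ i, n i - k) (by omega)]
  exact ⟨fun h => ⟨h.1, h.2, h.3⟩, fun h => ⟨h.1, h.2.1, h.2.2⟩⟩

end WeakSolution

/-! ### All solutions are multiples of one generator -/

section Lattice

variable {F : Type*} [Field F] {l : ℕ} {n : Fin l → ℕ} {u : Fin l → F}
  {v : (i : Fin l) → Fin (n i) → F}

theorem degree_mul_lt_of_add_le {f g : F[X]} {a b N : ℕ} (hf : f.degree < a) (hg : g.degree < b)
    (h : a + b ≤ N + 1) : (f * g).degree < N := by
  rcases eq_or_ne f 0 with rfl | hf0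
  · simp [bot_lt_iff_ne_bot]
  rcases eq_or_ne g 0 with rfl | hg0
  · simp [bot_lt_iff_ne_bot]
  rw [degree_mul, degree_eq_natDegree hf0, degree_eq_natDegree hg0]
  rw [← natDegree_lt_iff_degree_lt hf0] at hf
  rw [← natDegree_lt_iff_degree_lt hg0] at hg
  exact_mod_cast (by omega : f.natDegree + g.natDegree < N)

/-- The truncated subtraction is intended: for `a ≤ f.natDegree` the bound is `0` and forces `q =
0`. -/
theorem degree_mul_lt_iff {f : F[X]} (hf : f ≠ 0) (q : F[X]) (a : ℕ) :
    (q * f).degree < a ↔ q.degree < ((a - f.natDegree : ℕ) : WithBot ℕ) := by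
  rcases eq_or_ne q 0 with rfl | hq
  · simp [bot_lt_iff_ne_bot]
  rw [← natDegree_lt_iff_degree_lt hq, ← natDegree_lt_iff_degree_lt (mul_ne_zero hq hf),
    natDegree_mul hq hf]
  omega

theorem degree_lt_of_coeff_eq_zero {f : F[X]} {a : ℕ} (h : f.degree < ((a + 1 : ℕ) : WithBot ℕ))
    (h0 : f.coeff a = 0) : f.degree < a := by
  rw [degree_lt_iff_coeff_zero] at h ⊢
  intro m hm
  rcases hm.eq_or_lt with rfl | hm
  · exact h0
  · exact h m hm

theorem eq_zero_of_forall_pow_dvd (hu : Function.Injective u) {f : F[X]}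
    (h : ∀ i, (X - C (u i)) ^ n i ∣ f) (hf : f.degree < (∑ i, n i : ℕ)) : f = 0 := by
  have hprod : ∏ i, (X - C (u i)) ^ n i ∣ f :=
    Finset.prod_dvd_of_coprime
      (fun i _ i' _ hii => (pairwise_coprime_X_sub_C hu hii).pow) fun i _ => h i
  refine eq_zero_of_dvd_of_degree_lt hprod ?_
  rw [degree_prod]
  simpa [degree_pow] using hf

/-- With `f` the local interpolant, `A B' - A' B = (A - f B) B' - (A' - f B') B`, so the difference
is divisible by every `(X - u_i)^(n_i)` while its degree is below `N`. -/
theorem Interpolates.cross_eq (hu : Function.Injective u) {A B A' B' : F[X]}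
    (h : Interpolates u v A B) (h' : Interpolates u v A' B')
    (h1 : (A * B').degree < (∑ i, n i : ℕ)) (h2 : (A' * B).degree < (∑ i, n i : ℕ)) :
    A * B' = A' * B := by
  rw [← sub_eq_zero]
  refine eq_zero_of_forall_pow_dvd hu (n := n) (fun i => ?_)
    ((degree_sub_le _ _).trans_lt (max_lt h1 h2))
  have := dvd_sub ((h i).mul_right B') ((h' i).mul_right B)
  convert this using 1
  ring

theorem cross_eq_of_mem_solutions (hu : Function.Injective u) {p p' : F[X] × F[X]}
    {a b a' b' : ℕ} (h : p ∈ solutions u v a b) (h' : p' ∈ solutions u v a' b')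
    (h1 : a + b' ≤ ∑ i, n i + 1) (h2 : a' + b ≤ ∑ i, n i + 1) :
    p.1 * p'.2 = p'.1 * p.2 := by
  rw [mem_solutions] at h h'
  exact h.2.2.cross_eq hu h'.2.2 (degree_mul_lt_of_add_le h.1 h'.2.1 h1)
    (degree_mul_lt_of_add_le h'.1 h.2.1 h2)

theorem snd_ne_zero_of_mem_solutions (hu : Function.Injective u) {p : F[X] × F[X]} {a b : ℕ}
    (ha : a ≤ ∑ i, n i) (h : p ∈ solutions u v a b) (hp : p ≠ 0) : p.2 ≠ 0 := by
  intro h0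
  rw [mem_solutions] at h
  have h1 : p.1 = 0 := by
    refine eq_zero_of_forall_pow_dvd hu (n := n) (fun i => ?_)
      (h.1.trans_le (by exact_mod_cast ha))
    simpa [h0] using h.2.2 i
  exact hp (Prod.ext h1 h0)

theorem exists_ne_zero_mem_solutions (u : Fin l → F) (v : (i : Fin l) → Fin (n i) → F) {k : ℕ}
    (hk : k ≤ ∑ i, n i + 1) : ∃ p ∈ solutions u v k (∑ i, n i + 1 - k), p ≠ 0 := by
  have hker : LinearMap.ker (hermiteMatrix u v k (∑ i, n i + 1)).mulVecLin ≠ ⊥ := by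
    apply LinearMap.ker_ne_bot_of_finrank_lt
    simp
  obtain ⟨c, hc, hc0⟩ := Submodule.exists_mem_ne_zero_of_ne_bot hker
  refine ⟨toPair F k _ c, ?_, ?_⟩
  · rw [← map_ker_hermiteMatrix u v hk]
    exact Submodule.mem_map_of_mem hc
  · rwa [Ne, map_eq_zero_iff _ (toPair_injective k _)]

/-- A generator of the solutions for the degree bounds `k - 1` and `N - k`. -/
structure IsGenerator (u : Fin l → F) (v : (i : Fin l) → Fin (n i) → F) (k : ℕ)
    (g : F[X] × F[X]) : Prop where
  mem : g ∈ solutions u v k (∑ i, n i + 1 - k)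
  snd_ne_zero : g.2 ≠ 0
  exists_smul_eq : ∀ p : F[X] × F[X], Interpolates u v p.1 p.2 → p.1 * g.2 = g.1 * p.2 →
    ∃ q : F[X], p = q • g

/-- A nonzero solution with denominator of least degree generates: dividing another denominator by
it leaves a remainder pair which is again proportional to it, hence a solution within the same
bounds with smaller denominator, hence zero. The generator property imposes no degree bound on `p`,
so it also serves for other bounds. -/
theorem exists_isGenerator (hu : Function.Injective u) (v : (i : Fin l) → Fin (n i) → F) {k : ℕ}
    (hkN : k ≤ ∑ i, n i) : ∃ g, IsGenerator u v k g := by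
  obtain ⟨p, hp, hp0⟩ := exists_ne_zero_mem_solutions u v (hkN.trans (Nat.le_succ _))
  let S : Set (F[X] × F[X]) := {p | p ∈ solutions u v k (∑ i, n i + 1 - k) ∧ p ≠ 0}
  obtain ⟨g, ⟨hg, hg0⟩, hmin⟩ : ∃ g ∈ S, ∀ q ∈ S, ¬ q.2.degree < g.2.degree :=
    (wellFounded_lt.onFun (f := fun p : F[X] × F[X] => p.2.degree)).has_min S ⟨p, hp, hp0⟩
  have hg2 := snd_ne_zero_of_mem_solutions hu hkN hg hg0
  refine ⟨g, hg, hg2, fun p hp hcross => ⟨p.2 / g.2, ?_⟩⟩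
  have hr : (p - (p.2 / g.2) • g).2 = p.2 % g.2 := by
    have := EuclideanDomain.div_add_mod p.2 g.2
    simp only [Prod.snd_sub, Prod.smul_snd, smul_eq_mul]
    linear_combination -this
  by_contra hne
  have hne' : p - (p.2 / g.2) • g ≠ 0 := fun h => hne (sub_eq_zero.1 h)
  have hlt : (p - (p.2 / g.2) • g).2.degree < g.2.degree := by
    rw [hr]; exact degree_mod_lt _ hg2
  have hcr : (p - (p.2 / g.2) • g).1 * g.2 = g.1 * (p - (p.2 / g.2) • g).2 := by
    simp only [Prod.fst_sub, Prod.smul_fst, Prod.snd_sub, Prod.smul_snd, smul_eq_mul]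
    linear_combination hcross
  set r := p - (p.2 / g.2) • g
  have hrI : Interpolates u v r.1 r.2 :=
    (interpolatesSubmodule u v).sub_mem (x := p) hp
      ((interpolatesSubmodule u v).smul_mem _ (mem_solutions.1 hg).2.2)
  -- By the proportionality `hcr`, numerator and denominator degrees drop by the same amount.
  have hle : r.1.degree ≤ g.1.degree := by
    rcases eq_or_ne r.1 0 with h0 | h0
    · simp [h0]
    rcases eq_or_ne g.1 0 with hg1 | hg1
    · rw [hg1, zero_mul, mul_eq_zero] at hcr
      exact absurd hcr (by simp [h0, hg2])
    have hr2 : r.2 ≠ 0 := by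
      intro h
      rw [h, mul_zero, mul_eq_zero] at hcr
      exact absurd hcr (by simp [h0, hg2])
    have hd := congrArg natDegree hcr
    rw [natDegree_mul h0 hg2, natDegree_mul hg1 hr2] at hd
    rw [degree_eq_natDegree hr2, degree_eq_natDegree hg2] at hlt
    rw [degree_eq_natDegree h0, degree_eq_natDegree hg1]
    have : r.2.natDegree < g.2.natDegree := by exact_mod_cast hlt
    exact_mod_cast (by omega : r.1.natDegree ≤ g.1.natDegree)
  have hgm := mem_solutions.1 hg
  exact hmin r ⟨mem_solutions.2 ⟨hle.trans_lt hgm.1, hlt.trans hgm.2.1, hrI⟩, hne'⟩ hlt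

namespace IsGenerator

variable {k : ℕ} {g : F[X] × F[X]}

theorem ne_zero (hg : IsGenerator u v k g) : g ≠ 0 := fun h => hg.snd_ne_zero (by simp [h])

theorem exists_smul_eq_of_mem (hg : IsGenerator u v k g) (hu : Function.Injective u)
    {a b a' b' : ℕ} (hgm : g ∈ solutions u v a b) {p : F[X] × F[X]}
    (hp : p ∈ solutions u v a' b') (h1 : a + b' ≤ ∑ i, n i + 1) (h2 : a' + b ≤ ∑ i, n i + 1) :
    ∃ q : F[X], p = q • g :=
  hg.exists_smul_eq p (mem_solutions.1 hp).2.2 (cross_eq_of_mem_solutions hu hp hgm h2 h1)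

/-- The number `d` is the room left by the degrees of `g`: the smaller of the two gaps, or the
denominator gap alone when the numerator of `g` is zero. -/
theorem exists_smul_mem_iff (hg : IsGenerator u v k g) (a b : ℕ) :
    ∃ d : ℕ, ∀ q : F[X], q • g ∈ solutions u v a b ↔ q.degree < d := by
  have hI : ∀ q : F[X], Interpolates u v (q • g).1 (q • g).2 := fun q =>
    (interpolatesSubmodule u v).smul_mem q (mem_solutions.1 hg.mem).2.2
  have hiff : ∀ q : F[X], q • g ∈ solutions u v a b ↔
      (q * g.1).degree < a ∧ (q * g.2).degree < b := fun q => by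
    rw [mem_solutions]
    exact ⟨fun h => ⟨h.1, h.2.1⟩, fun h => ⟨h.1, h.2, hI q⟩⟩
  rcases eq_or_ne g.1 0 with h0 | h0
  · refine ⟨b - g.2.natDegree, fun q => ?_⟩
    rw [hiff, h0, degree_mul_lt_iff hg.snd_ne_zero]
    simp [bot_lt_iff_ne_bot]
  · refine ⟨min (a - g.1.natDegree) (b - g.2.natDegree), fun q => ?_⟩
    rw [hiff, degree_mul_lt_iff hg.snd_ne_zero, degree_mul_lt_iff h0, Nat.mono_cast.map_min,
      lt_min_iff]

/-- The solutions are the `q • g` with `deg q < d`, a space of dimension `d`. So `j ≤ d` iff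
`X^(j-1) • g` is a solution, that is, iff `g` obeys both bounds lowered by `j - 1`. -/
theorem le_finrank_iff (hg : IsGenerator u v k g) (hu : Function.Injective u)
    (hkN : k ≤ ∑ i, n i) {j : ℕ} (hj : 1 ≤ j) :
    j ≤ Module.finrank F (solutions u v k (∑ i, n i + 1 - k)) ↔
      g ∈ solutions u v (k + 1 - j) (∑ i, n i + 2 - k - j) := by
  obtain ⟨d, hd⟩ := hg.exists_smul_mem_iff k (∑ i, n i + 1 - k)
  let f : F[X] →ₗ[F] F[X] × F[X] := (LinearMap.toSpanSingleton F[X] _ g).restrictScalars F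
  have hf : Function.Injective f := by
    intro q q' h
    have h2 : q * g.2 = q' * g.2 := congrArg Prod.snd h
    exact mul_right_cancel₀ hg.snd_ne_zero h2
  have hmap : (degreeLT F d).map f = solutions u v k (∑ i, n i + 1 - k) := by
    ext p
    constructor
    · rintro ⟨q, hq, rfl⟩
      exact (hd q).2 (mem_degreeLT.1 hq)
    · intro hp
      obtain ⟨q, rfl⟩ := hg.exists_smul_eq_of_mem hu hg.mem hp (by omega) (by omega)
      exact ⟨q, mem_degreeLT.2 ((hd q).1 hp), rfl⟩
  have hfin : Module.finrank F (solutions u v k (∑ i, n i + 1 - k)) = d := by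
    rw [← hmap, ← (Submodule.equivMapOfInjective f hf _).finrank_eq,
      (degreeLTEquiv F d).finrank_eq]
    simp
  have hX := hd (X ^ (j - 1))
  rw [degree_X_pow] at hX
  have hI : Interpolates u v ((X : F[X]) ^ (j - 1) • g).1 ((X : F[X]) ^ (j - 1) • g).2 :=
    (interpolatesSubmodule u v).smul_mem _ (mem_solutions.1 hg.mem).2.2
  have hI' := (mem_solutions.1 hg.mem).2.2
  have hshift : ∀ (f : F[X]) (m m' : ℕ), m' = m + 1 - j →
      ((X ^ (j - 1) * f).degree < (m : WithBot ℕ) ↔ f.degree < (m' : WithBot ℕ)) := by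
    rintro f m _ rfl
    rw [mul_comm, degree_mul_lt_iff (by simp), natDegree_X_pow]
    rw [show m - (j - 1) = m + 1 - j by omega]
  rw [hfin, mem_solutions, ← hshift g.1 k (k + 1 - j) rfl,
    ← hshift g.2 (∑ i, n i + 1 - k) (∑ i, n i + 2 - k - j) (by omega)]
  rw [mem_solutions] at hX
  simp only [Prod.smul_fst, Prod.smul_snd, smul_eq_mul] at hX hI
  rw [show j ≤ d ↔ ((j - 1 : ℕ) : WithBot ℕ) < d from
    ⟨fun h => by exact_mod_cast (by omega : j - 1 < d), fun h => by
      have : j - 1 < d := by exact_mod_cast h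
      omega⟩, ← hX]
  simp only [hI, hI', and_true]

end IsGenerator

theorem solutions_mono {a b a' b' : ℕ} (ha : a ≤ a') (hb : b ≤ b') :
    solutions u v a b ≤ solutions u v a' b' := by
  intro p hp
  rw [mem_solutions] at hp ⊢
  exact ⟨hp.1.trans_le (by exact_mod_cast ha), hp.2.1.trans_le (by exact_mod_cast hb), hp.2.2⟩

end Lattice

/-! ### Vanishing minors and degree bounds of the generator -/

section Minors

variable {F : Type*} [Field F] {l : ℕ} {n : Fin l → ℕ} {u : Fin l → F}
  {v : (i : Fin l) → Fin (n i) → F}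

/-- The square matrix left after deleting column `c` is singular iff it has a nonzero kernel vector,
which extends by `0` in position `c`. -/
theorem signedMinor_eq_zero_iff (u : Fin l → F) (v : (i : Fin l) → Fin (n i) → F) (a : ℕ)
    (c : Fin (∑ i, n i + 1)) :
    signedMinor u v a ((c : ℕ) + 1) = 0 ↔
      ∃ w ≠ 0, (hermiteMatrix u v a (∑ i, n i + 1)).mulVec w = 0 ∧ w c = 0 := by
  have hc : Fin.ofNat (∑ i, n i + 1) ((c : ℕ) + 1 - 1) = c := by
    ext; simp
  rw [signedMinor, hc, mul_eq_zero, or_iff_right (by simp), ← Matrix.exists_mulVec_eq_zero_iff]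
  set M := hermiteMatrix u v a (∑ i, n i + 1)
  have key : ∀ w : Fin (∑ i, n i + 1) → F, w c = 0 →
      (M.mulVec w = 0 ↔ (M.submatrix finSigmaFinEquiv.symm c.succAbove).mulVec
        (fun i => w (c.succAbove i)) = 0) := by
    intro w hw
    have : ∀ r, (M.submatrix finSigmaFinEquiv.symm c.succAbove).mulVec
        (fun i => w (c.succAbove i)) r = M.mulVec w (finSigmaFinEquiv.symm r) := by
      intro r
      simp [Matrix.mulVec, dotProduct, Fin.sum_univ_succAbove _ c, hw]
    simp only [funext_iff, this, Pi.zero_apply]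
    exact ⟨fun h r => h _, fun h r => by simpa using h (finSigmaFinEquiv r)⟩
  constructor
  · rintro ⟨x, hx, h⟩
    refine ⟨c.insertNth 0 x, fun h0 => hx ?_, ?_, by simp⟩
    · funext i
      simpa using congrFun h0 (c.succAbove i)
    · rw [key _ (by simp)]
      simpa using h
  · rintro ⟨w, hw, h, hc⟩
    refine ⟨fun i => w (c.succAbove i), fun h0 => hw ?_, (key w hc).1 h⟩
    funext i
    rcases Fin.eq_self_or_eq_succAbove c i with rfl | ⟨i, rfl⟩
    · exact hc
    · exact congrFun h0 i

/-- Repeating row `r` on top gives a square matrix with two equal rows; expanding its zero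
determinant along the top row is the claim, up to the global sign coming from counting columns from
`1`. -/
theorem hermiteMatrix_mulVec_signedMinor {R : Type*} [CommRing R] (u : Fin l → R)
    (v : (i : Fin l) → Fin (n i) → R) (a : ℕ) :
    (hermiteMatrix u v a (∑ i, n i + 1)).mulVec (fun c => signedMinor u v a ((c : ℕ) + 1)) = 0 := by
  funext r
  set M := hermiteMatrix u v a (∑ i, n i + 1) with hM
  let r' := finSigmaFinEquiv r
  let A : Matrix (Fin (∑ i, n i + 1)) (Fin (∑ i, n i + 1)) R :=
    Matrix.of (Fin.cons (M r) fun i => M (finSigmaFinEquiv.symm i))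
  have hA : A.det = 0 := by
    refine Matrix.det_zero_of_row_eq (Fin.succ_ne_zero r').symm ?_
    ext c
    simp [A, r']
  rw [Matrix.det_succ_row_zero] at hA
  rw [Matrix.mulVec, dotProduct, Pi.zero_apply, ← neg_eq_zero, ← hA, ← Finset.sum_neg_distrib]
  refine Finset.sum_congr rfl fun c _ => ?_
  have hc : Fin.ofNat (∑ i, n i + 1) ((c : ℕ) + 1 - 1) = c := by
    ext; simp
  rw [signedMinor, hc, ← hM]
  have : A.submatrix Fin.succ c.succAbove = M.submatrix finSigmaFinEquiv.symm c.succAbove := by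
    ext i j; simp [A]
  rw [this]
  simp only [A, Matrix.of_apply, Fin.cons_zero]
  ring

/-- The deleted column carries the top numerator coefficient, that of `X^a`; its vanishing lowers
the numerator bound from `a + 1` to `a`. -/
theorem signedMinor_self_eq_zero_iff (u : Fin l → F) (v : (i : Fin l) → Fin (n i) → F) {a : ℕ}
    (ha : a ≤ ∑ i, n i) : signedMinor u v (a + 1) (a + 1) = 0 ↔
      ∃ p ∈ solutions u v a (∑ i, n i - a), p ≠ 0 := by
  rw [signedMinor_eq_zero_iff u v (a + 1) ⟨a, by omega⟩]
  constructor
  · rintro ⟨w, hw, h, h0⟩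
    refine ⟨toPair F (a + 1) _ w, ?_, by rwa [Ne, map_eq_zero_iff _ (toPair_injective _ _)]⟩
    have hmem : toPair F (a + 1) _ w ∈ solutions u v (a + 1) (∑ i, n i + 1 - (a + 1)) := by
      rw [← map_ker_hermiteMatrix u v (by omega)]
      exact Submodule.mem_map_of_mem h
    rw [mem_solutions] at hmem ⊢
    refine ⟨degree_lt_of_coeff_eq_zero hmem.1 ?_, by simpa using hmem.2.1, hmem.2.2⟩
    rw [← h0]
    exact toPair_fst_coeff w ⟨a, by omega⟩ (Nat.lt_succ_self a)
  · rintro ⟨p, hp, hp0⟩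
    have hmem : p ∈ solutions u v (a + 1) (∑ i, n i + 1 - (a + 1)) :=
      solutions_mono (Nat.le_succ a) (by omega) hp
    rw [← map_ker_hermiteMatrix u v (by omega)] at hmem
    obtain ⟨w, hw, rfl⟩ := hmem
    refine ⟨w, fun h => hp0 (by rw [h, map_zero]), hw, ?_⟩
    rw [← toPair_fst_coeff w ⟨a, by omega⟩ (Nat.lt_succ_self a)]
    exact coeff_eq_zero_of_degree_lt (mem_solutions.1 hp).1

/-- Here the deleted column carries the top denominator coefficient. The criterion is that of
`signedMinor_self_eq_zero_iff`, so `Δ_{a,N+1}` and `Δ_{a+1,a+1}` vanish together. -/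
theorem signedMinor_last_eq_zero_iff (u : Fin l → F) (v : (i : Fin l) → Fin (n i) → F) {a : ℕ}
    (ha : a ≤ ∑ i, n i) : signedMinor u v a (∑ i, n i + 1) = 0 ↔
      ∃ p ∈ solutions u v a (∑ i, n i - a), p ≠ 0 := by
  have hlast := fun w : Fin (∑ i, n i + 1) → F =>
    toPair_snd_coeff (a := a) w (Fin.last _) (by simpa using ha)
  simp only [Fin.val_last] at hlast
  have := signedMinor_eq_zero_iff u v a (Fin.last _)
  rw [Fin.val_last] at this
  rw [this]
  constructor
  · rintro ⟨w, hw, h, h0⟩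
    refine ⟨toPair F a _ w, ?_, by rwa [Ne, map_eq_zero_iff _ (toPair_injective _ _)]⟩
    have hmem : toPair F a _ w ∈ solutions u v a (∑ i, n i + 1 - a) := by
      rw [← map_ker_hermiteMatrix u v (by omega)]
      exact Submodule.mem_map_of_mem h
    rw [mem_solutions] at hmem ⊢
    refine ⟨hmem.1, degree_lt_of_coeff_eq_zero ?_ ((hlast w).trans h0), hmem.2.2⟩
    rw [show ∑ i, n i - a + 1 = ∑ i, n i + 1 - a by omega]
    exact hmem.2.1
  · rintro ⟨p, hp, hp0⟩
    have hmem : p ∈ solutions u v a (∑ i, n i + 1 - a) :=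
      solutions_mono le_rfl (by omega) hp
    rw [← map_ker_hermiteMatrix u v (by omega)] at hmem
    obtain ⟨w, hw, rfl⟩ := hmem
    refine ⟨w, fun h => hp0 (by rw [h, map_zero]), hw, ?_⟩
    rw [← hlast w]
    exact coeff_eq_zero_of_degree_lt (mem_solutions.1 hp).2.1

theorem toPair_signedMinor_mem (u : Fin l → F) (v : (i : Fin l) → Fin (n i) → F) {a : ℕ}
    (ha : a ≤ ∑ i, n i + 1) :
    toPair F a (∑ i, n i + 1) (fun c => signedMinor u v a ((c : ℕ) + 1)) ∈
      solutions u v a (∑ i, n i + 1 - a) := by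
  rw [← map_ker_hermiteMatrix u v ha]
  exact Submodule.mem_map_of_mem (hermiteMatrix_mulVec_signedMinor u v a)

namespace IsGenerator

variable {k : ℕ} {g : F[X] × F[X]}

/-- Each of the two minors supplies a nonzero solution which must be a multiple of `g`. The one from
`Δ_{k-j+1,k-j+1}` has a smaller numerator bound, the one from `Δ_{k+j,k+j}` a smaller denominator
bound, and `g` inherits both. -/
theorem mem_solutions_succ_iff (hg : IsGenerator u v k g) (hu : Function.Injective u) {j : ℕ}
    (hj : 1 ≤ j) (hjk : j ≤ k) (hjN : k + j ≤ ∑ i, n i + 1) :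
    g ∈ solutions u v (k - j) (∑ i, n i + 1 - k - j) ↔
      g ∈ solutions u v (k + 1 - j) (∑ i, n i + 2 - k - j) ∧
        signedMinor u v (k - j + 1) (k - j + 1) = 0 ∧ signedMinor u v (k + j) (k + j) = 0 := by
  obtain ⟨m, hm⟩ : ∃ m, k + j = m + 1 := ⟨k + j - 1, by omega⟩
  rw [hm, signedMinor_self_eq_zero_iff u v (by omega), signedMinor_self_eq_zero_iff u v (by omega)]
  constructor
  · intro h
    exact ⟨solutions_mono (by omega) (by omega) h,
      ⟨g, solutions_mono le_rfl (by omega) h, hg.ne_zero⟩,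
      ⟨g, solutions_mono (by omega) (by omega) h, hg.ne_zero⟩⟩
  · rintro ⟨h, ⟨p, hp, hp0⟩, ⟨p', hp', hp'0⟩⟩
    obtain ⟨q, rfl⟩ := hg.exists_smul_eq_of_mem hu h hp (by omega) (by omega)
    obtain ⟨q', rfl⟩ := hg.exists_smul_eq_of_mem hu h hp' (by omega) (by omega)
    rw [mem_solutions] at hp hp' h ⊢
    have hq : q ≠ 0 := fun h0 => hp0 (by simp [h0])
    have hq' : q' ≠ 0 := fun h0 => hp'0 (by simp [h0])
    refine ⟨(degree_le_mul_left _ hq).trans_lt ((mul_comm g.1 q) ▸ hp.1), ?_, h.2.2⟩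
    rw [show ∑ i, n i + 1 - k - j = ∑ i, n i - m by omega]
    exact (degree_le_mul_left _ hq').trans_lt ((mul_comm g.2 q') ▸ hp'.2.1)

theorem mem_solutions_iff_minors (hg : IsGenerator u v k g) (hu : Function.Injective u) {j : ℕ}
    (hj : 1 ≤ j) (hjk : j ≤ k) (hjN : k + j ≤ ∑ i, n i + 1) :
    g ∈ solutions u v (k + 1 - j) (∑ i, n i + 2 - k - j) ↔
      ∀ a ∈ Finset.Icc (k - j + 2) (k + j - 1), signedMinor u v a a = 0 := by
  induction j, hj using Nat.le_induction with
  | base =>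
    refine iff_of_true ?_ fun a ha => ?_
    · exact solutions_mono (by omega) (by omega) hg.mem
    · rw [Finset.mem_Icc] at ha; omega
  | succ j hj ih =>
    have := hg.mem_solutions_succ_iff hu hj (by omega) (by omega)
    rw [show k + 1 - (j + 1) = k - j by omega,
      show ∑ i, n i + 2 - k - (j + 1) = ∑ i, n i + 1 - k - j by omega, this,
      ih (by omega) (by omega)]
    constructor
    · rintro ⟨h, h1, h2⟩ a ha
      rw [Finset.mem_Icc] at ha
      rcases eq_or_ne a (k - j + 1) with rfl | ha1
      · exact h1
      rcases eq_or_ne a (k + j) with rfl | ha2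
      · exact h2
      exact h a (Finset.mem_Icc.2 (by omega))
    · intro h
      refine ⟨fun a ha => h a ?_, h _ ?_, h _ ?_⟩ <;> rw [Finset.mem_Icc] at * <;> omega

theorem finrank_eq_iff (hg : IsGenerator u v k g) (hu : Function.Injective u)
    (hkN : k ≤ ∑ i, n i) {j : ℕ} (hj : 1 ≤ j) :
    Module.finrank F (solutions u v k (∑ i, n i + 1 - k)) = j ↔
      g ∈ solutions u v (k + 1 - j) (∑ i, n i + 2 - k - j) ∧
        g ∉ solutions u v (k - j) (∑ i, n i + 1 - k - j) := by
  have h1 := hg.le_finrank_iff hu hkN hj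
  have h2 := hg.le_finrank_iff hu hkN (Nat.le_succ_of_le hj)
  rw [show k + 1 - j.succ = k - j by omega,
    show ∑ i, n i + 2 - k - j.succ = ∑ i, n i + 1 - k - j by omega] at h2
  rw [← h1, ← h2]
  omega

end IsGenerator

end Minors

/-! ### Minimal solutions and their explicit form -/

section MinimalSolutions

variable {K : Type*} [Field K] {l : ℕ} {n : Fin l → ℕ} {u : Fin l → K}
  {v : (i : Fin l) → Fin (n i) → K} {k : ℕ} {g : K[X] × K[X]}

namespace IsGenerator

/-- Nonzero solutions are `q g` with `q ≠ 0`, so minimality means that `q` is constant. The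
numerator degree detects this unless the numerator of `g` is zero, when the denominator degree does.
-/
theorem isMinimalSolution_iff (hg : IsGenerator u v k g) (hu : Function.Injective u)
    (hchar : ringChar K = 0 ∨ ∀ i, n i ≤ ringChar K) (hk : 1 ≤ k) (hkN : k ≤ ∑ i, n i)
    (A B : K[X]) :
    IsMinimalSolution u v k A B ↔ ∃ c : K, c ≠ 0 ∧ A = C c * g.1 ∧ B = C c * g.2 := by
  have hsol := isWeakSolution_iff hchar u v hk hkN
  have hmul : ∀ A B : K[X], IsWeakSolution u v k A B → ∃ q : K[X], A = q * g.1 ∧ B = q * g.2 := by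
    intro A B h
    obtain ⟨q, hq⟩ := hg.exists_smul_eq_of_mem hu hg.mem ((hsol A B).1 h) (by omega) (by omega)
    exact ⟨q, congrArg Prod.fst hq, congrArg Prod.snd hq⟩
  have hg1 : IsWeakSolution u v k g.1 g.2 := (hsol _ _).2 hg.mem
  have hg0 : (g.1, g.2) ≠ (0, 0) := hg.ne_zero
  constructor
  · intro h
    obtain ⟨q, rfl, rfl⟩ := hmul A B h.isSolution
    have hq : q ≠ 0 := by
      rintro rfl
      exact h.ne_zero (by simp)
    have hdeg : q.natDegree = 0 := by
      rcases eq_or_ne g.1 0 with h0 | h0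
      · have := h.degree_den_le _ _ hg1 hg0 (by rw [h0, mul_zero])
        rw [degree_mul, degree_eq_natDegree hq, degree_eq_natDegree hg.snd_ne_zero] at this
        have : q.natDegree + g.2.natDegree ≤ g.2.natDegree := by exact_mod_cast this
        omega
      · have := h.degree_num_le _ _ hg1 hg0
        rw [degree_mul, degree_eq_natDegree hq, degree_eq_natDegree h0] at this
        have : q.natDegree + g.1.natDegree ≤ g.1.natDegree := by exact_mod_cast this
        omega
    rw [eq_C_of_natDegree_eq_zero hdeg] at hq ⊢
    exact ⟨q.coeff 0, by simpa using hq, rfl, rfl⟩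
  · rintro ⟨c, hc, rfl, rfl⟩
    have hle : ∀ (q f : K[X]), q ≠ 0 → f.degree ≤ (q * f).degree := fun q f hq =>
      (degree_le_mul_left f hq).trans_eq (by rw [mul_comm])
    refine ⟨(hsol _ _).2 ?_, ?_, ?_, ?_⟩
    · exact (smul_eq_C_mul c (p := g.1)) ▸ (smul_eq_C_mul c (p := g.2)) ▸
        (solutions u v k _).smul_mem c hg.mem
    · intro h
      exact mul_ne_zero (C_ne_zero.2 hc) hg.snd_ne_zero (congrArg Prod.snd h)
    · intro A' B' h h0
      obtain ⟨q, rfl, rfl⟩ := hmul A' B' h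
      rw [degree_C_mul hc]
      exact hle _ _ (by rintro rfl; exact h0 (by simp))
    · intro A' B' h h0 _
      obtain ⟨q, rfl, rfl⟩ := hmul A' B' h
      rw [degree_C_mul hc]
      exact hle _ _ (by rintro rfl; exact h0 (by simp))

theorem degree_le_iff_mem_solutions (hg : IsGenerator u v k g) {j : ℕ} (hjk : j ≤ k)
    (hkN : k ≤ ∑ i, n i) (hjN : k + j ≤ ∑ i, n i + 1) :
    (g.1.degree ≤ ((k - j : ℕ) : WithBot ℕ) ∧
      g.2.degree ≤ ((∑ i, n i - k + 1 - j : ℕ) : WithBot ℕ)) ↔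
      g ∈ solutions u v (k + 1 - j) (∑ i, n i + 2 - k - j) := by
  rw [mem_solutions, degree_le_iff_degree_lt (m' := k + 1 - j) (by omega),
    degree_le_iff_degree_lt (m' := ∑ i, n i + 2 - k - j) (by omega)]
  exact ⟨fun h => ⟨h.1, h.2, (mem_solutions.1 hg.mem).2.2⟩, fun h => ⟨h.1, h.2.1⟩⟩

theorem degree_eq_iff_notMem_solutions (hg : IsGenerator u v k g) {j : ℕ}
    (hkN : k ≤ ∑ i, n i) (h : g.1.degree ≤ ((k - j : ℕ) : WithBot ℕ) ∧
      g.2.degree ≤ ((∑ i, n i - k + 1 - j : ℕ) : WithBot ℕ)) :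
    (g.1.degree = ((k - j : ℕ) : WithBot ℕ) ∨
      g.2.degree = ((∑ i, n i - k + 1 - j : ℕ) : WithBot ℕ)) ↔
      g ∉ solutions u v (k - j) (∑ i, n i + 1 - k - j) := by
  rw [mem_solutions, and_iff_left (mem_solutions.1 hg.mem).2.2, not_and_or, not_lt, not_lt,
    show ∑ i, n i + 1 - k - j = ∑ i, n i - k + 1 - j by omega]
  exact or_congr ⟨fun h => h.ge, fun h' => le_antisymm h.1 h'⟩
    ⟨fun h => h.ge, fun h' => le_antisymm h.2 h'⟩

end IsGenerator

/-- A subspace on which one linear form is injective has dimension at most one. -/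
theorem exists_eq_smul_of_ker_eq_bot {V : Type*} [AddCommGroup V] [Module K V]
    {W : Submodule K V} {φ : V →ₗ[K] K} (hφ : ∀ p ∈ W, φ p = 0 → p = 0) {p g : V} (hp : p ∈ W)
    (hg : g ∈ W) (hp0 : p ≠ 0) (hg0 : g ≠ 0) : ∃ c : K, c ≠ 0 ∧ p = c • g := by
  have h1 : φ p ≠ 0 := fun h => hp0 (hφ p hp h)
  have h2 : φ g ≠ 0 := fun h => hg0 (hφ g hg h)
  refine ⟨φ p / φ g, div_ne_zero h1 h2, sub_eq_zero.1 (hφ _ (W.sub_mem hp (W.smul_mem _ hg)) ?_)⟩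
  rw [map_sub, map_smul, smul_eq_mul, div_mul_cancel₀ _ h2, sub_self]

theorem toPair_fst_eq_sum {a w m : ℕ} (f : ℕ → K) (hm : m < a) (ha : a ≤ w)
    (hf : ∀ i, m < i → i < a → f i = 0) :
    (toPair K a w fun j => f j).1 = ∑ i ∈ Finset.Icc 0 m, C (f i) * X ^ i := by
  rw [toPair_fst, Fin.sum_univ_eq_sum_range (fun i => if i < a then C (f i) * X ^ i else 0) w]
  symm
  refine Finset.sum_subset_zero_on_sdiff ?_ ?_ ?_
  · intro i hi
    simp only [Finset.mem_Icc, Finset.mem_range] at *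
    omega
  · intro i hi
    simp only [Finset.mem_Icc, Finset.mem_range, Finset.mem_sdiff] at hi
    split_ifs with h
    · rw [hf i (by omega) h]; simp
    · rfl
  · intro i hi
    simp only [Finset.mem_Icc] at hi
    rw [if_pos (by omega)]

theorem toPair_snd_eq_sum {a w m : ℕ} (f : ℕ → K) (hm : m < w)
    (hf : ∀ i, a ≤ i → m < i → i < w → f i = 0) :
    (toPair K a w fun j => f j).2 = ∑ i ∈ Finset.Icc a m, C (f i) * X ^ (i - a) := by
  rw [toPair_snd,
    Fin.sum_univ_eq_sum_range (fun i => if i < a then 0 else C (f i) * X ^ (i - a)) w]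
  symm
  refine Finset.sum_subset_zero_on_sdiff ?_ ?_ ?_
  · intro i hi
    simp only [Finset.mem_Icc, Finset.mem_range] at *
    omega
  · intro i hi
    simp only [Finset.mem_Icc, Finset.mem_range, Finset.mem_sdiff] at hi
    split_ifs with h
    · rfl
    · rw [hf i (by omega) (by omega) (by omega)]; simp
  · intro i hi
    simp only [Finset.mem_Icc] at hi
    rw [if_neg (by omega)]

namespace IsGenerator

/-- The pair of polynomials whose coefficients are the signed minors, written with truncated sums,
is proportional to a generator as soon as the two are proportional as solutions. -/
theorem minors_eq_smul (hg : IsGenerator u v k g) {j a : ℕ} (hjk : j ≤ k)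
    (hjN : k + j ≤ ∑ i, n i + 1)
    (h : g ∈ solutions u v (k + 1 - j) (∑ i, n i + 2 - k - j)) (ha : k - j < a)
    (ha' : a + (∑ i, n i + 2 - k - j) ≤ ∑ i, n i + 1)
    {φ : K[X] × K[X] →ₗ[K] K}
    (hφ : ∀ p ∈ solutions u v a (∑ i, n i + 1 - a), φ p = 0 → p = 0)
    (h0 : ∃ i ≤ ∑ i, n i, signedMinor u v a (i + 1) ≠ 0) :
    ∃ c : K, c ≠ 0 ∧
      ∑ i ∈ Finset.Icc 0 (k - j), C (signedMinor u v a (i + 1)) * X ^ i = C c * g.1 ∧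
      ∑ i ∈ Finset.Icc a (a + (∑ i, n i + 1 - k - j)),
        C (signedMinor u v a (i + 1)) * X ^ (i - a) = C c * g.2 := by
  have hmem := toPair_signedMinor_mem u v (a := a) (by omega)
  have hne : toPair K a (∑ i, n i + 1) (fun c => signedMinor u v a ((c : ℕ) + 1)) ≠ 0 := by
    obtain ⟨i, hi, hi0⟩ := h0
    rw [Ne, map_eq_zero_iff _ (toPair_injective _ _)]
    exact fun h => hi0 (congrFun h ⟨i, by omega⟩)
  obtain ⟨c, hc, hp⟩ := exists_eq_smul_of_ker_eq_bot hφ hmem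
    (solutions_mono (by omega) (by omega) h) hne hg.ne_zero
  have hgd := mem_solutions.1 h
  refine ⟨c, hc, ?_, ?_⟩
  · rw [← smul_eq_C_mul, ← Prod.smul_fst, ← hp]
    -- The sum may stop at `k - j`: the minors beyond are coefficients of `c • g` above its degree
    -- bound.
    refine (toPair_fst_eq_sum _ ha (by omega) fun i hi hia => ?_).symm
    have := toPair_fst_coeff (a := a) (fun c : Fin (∑ i, n i + 1) =>
      signedMinor u v a ((c : ℕ) + 1)) ⟨i, by omega⟩ hia
    rw [hp, Prod.smul_fst, coeff_smul, coeff_eq_zero_of_degree_lt (hgd.1.trans_le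
      (by exact_mod_cast (by omega : k + 1 - j ≤ i))), smul_zero] at this
    exact this.symm
  · rw [← smul_eq_C_mul, ← Prod.smul_snd, ← hp]
    refine (toPair_snd_eq_sum _ (by omega) fun i hai hi hiN => ?_).symm
    have := toPair_snd_coeff (a := a) (fun c : Fin (∑ i, n i + 1) =>
      signedMinor u v a ((c : ℕ) + 1)) ⟨i, hiN⟩ hai
    rw [hp, Prod.smul_snd, coeff_smul, coeff_eq_zero_of_degree_lt (hgd.2.1.trans_le
      (by exact_mod_cast (by omega : ∑ i, n i + 2 - k - j ≤ i - a))), smul_zero] at this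
    exact this.symm

/-- If `Δ_{k-j+1,k-j+1} ≠ 0`, no nonzero solution for `a = k - j + 1` has zero coefficient at
`X^(k-j)`; this coefficient is the injective linear form that makes the solution space a line. -/
theorem exists_left_minors_eq (hg : IsGenerator u v k g) {j : ℕ} (hj : 1 ≤ j)
    (hjk : j ≤ k) (hjN : k + j ≤ ∑ i, n i + 1)
    (h : g ∈ solutions u v (k + 1 - j) (∑ i, n i + 2 - k - j))
    (h0 : signedMinor u v (k - j + 1) (k - j + 1) ≠ 0) :
    ∃ c : K, c ≠ 0 ∧
      ∑ i ∈ Finset.Icc 0 (k - j), C (signedMinor u v (k - j + 1) (i + 1)) * X ^ i = C c * g.1 ∧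
      ∑ i ∈ Finset.Icc (k - j + 1) (∑ i, n i + 2 - 2 * j),
        C (signedMinor u v (k - j + 1) (i + 1)) * X ^ (i - (k - j + 1)) = C c * g.2 := by
  have hb : ∑ i, n i + 2 - 2 * j = k - j + 1 + (∑ i, n i + 1 - k - j) := by omega
  rw [hb]
  refine hg.minors_eq_smul (φ := lcoeff K (k - j) ∘ₗ LinearMap.fst K _ _) hjk hjN h
    (by omega) (by omega) (fun p hp hp0 => ?_) ⟨k - j, by omega, h0⟩
  by_contra hne
  refine h0 ((signedMinor_self_eq_zero_iff u v (by omega)).2 ⟨p, ?_, hne⟩)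
  rw [mem_solutions] at hp ⊢
  refine ⟨degree_lt_of_coeff_eq_zero hp.1 hp0, ?_, hp.2.2⟩
  rw [show ∑ i, n i - (k - j) = ∑ i, n i + 1 - (k - j + 1) by omega]
  exact hp.2.1

/-- The mirror case `a = k + j - 1`, with the top denominator coefficient as linear form. The
hypothesis on `Δ_{k+j,k+j}` becomes one on `Δ_{k+j-1,N+1}`, since these two vanish together. -/
theorem exists_right_minors_eq (hg : IsGenerator u v k g) {j : ℕ} (hj : 1 ≤ j)
    (hjk : j ≤ k) (hjN : k + j ≤ ∑ i, n i + 1)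
    (h : g ∈ solutions u v (k + 1 - j) (∑ i, n i + 2 - k - j))
    (h0 : signedMinor u v (k + j) (k + j) ≠ 0) :
    ∃ c : K, c ≠ 0 ∧
      ∑ i ∈ Finset.Icc 0 (k - j), C (signedMinor u v (k + j - 1) (i + 1)) * X ^ i = C c * g.1 ∧
      ∑ i ∈ Finset.Icc (k + j - 1) (∑ i, n i),
        C (signedMinor u v (k + j - 1) (i + 1)) * X ^ (i - (k + j - 1)) = C c * g.2 := by
  obtain ⟨m, hm⟩ : ∃ m, k + j = m + 1 := ⟨k + j - 1, by omega⟩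
  have hlast : signedMinor u v m (∑ i, n i + 1) ≠ 0 := by
    rw [Ne, signedMinor_last_eq_zero_iff u v (by omega),
      ← signedMinor_self_eq_zero_iff u v (by omega), ← hm]
    exact h0
  have hb : ∑ i, n i = m + (∑ i, n i + 1 - k - j) := by omega
  have key := hg.minors_eq_smul (a := m)
    (φ := lcoeff K (∑ i, n i - m) ∘ₗ LinearMap.snd K _ _) hjk hjN h
    (by omega) (by omega) (fun p hp hp0 => ?_) ⟨∑ i, n i, le_rfl, hlast⟩
  · rw [← hb] at key
    rw [show k + j - 1 = m by omega]
    exact key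
  by_contra hne
  refine hlast ((signedMinor_last_eq_zero_iff u v (by omega)).2 ⟨p, ?_, hne⟩)
  rw [mem_solutions] at hp ⊢
  refine ⟨hp.1, degree_lt_of_coeff_eq_zero ?_ hp0, hp.2.2⟩
  rw [show ∑ i, n i - m + 1 = ∑ i, n i + 1 - m by omega]
  exact hp.2.1

end IsGenerator

end MinimalSolutions

/-! ### Heights of kernels and transcendence degree -/

section Dimension

theorem comap_C_map_C {R : Type*} [CommRing R] (P : Ideal R) : (P.map C).comap C = P := by
  ext x
  rw [Ideal.mem_comap, Ideal.mem_map_C_iff]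
  refine ⟨fun h => by simpa using h 0, fun h m => ?_⟩
  rw [coeff_C]
  split_ifs
  · exact h
  · exact P.zero_mem

theorem height_le_height_map_C {R : Type*} [CommRing R] [IsNoetherianRing R] (P : Ideal R)
    [P.IsPrime] : P.height ≤ (P.map C).height := by
  have : (P.map (C : R →+* R[X])).IsPrime := Ideal.isPrime_map_C_of_isPrime
  have : (P.map (C : R →+* R[X])).LiesOver P := ⟨(comap_C_map_C P).symm⟩
  rw [Ideal.height_eq_height_add_of_liesOver_of_hasGoingDown P (P.map C)]
  exact le_self_add

variable {K : Type*} [Field K] {L : Type*} [Field L] [Algebra K L]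

/-- One half of the dimension formula, by induction on the number of variables: each new variable
contributes either an independent element of the image or one more step of height. -/
theorem exists_algebraicIndependent_of_ker (σ : Type) [Finite σ] :
    ∀ φ : MvPolynomial σ K →ₐ[K] L, ∃ (ι : Type) (_ : Finite ι) (y : ι → L),
      AlgebraicIndependent K y ∧ (∀ i, y i ∈ φ.range) ∧
      (Nat.card σ : ℕ∞) ≤ (RingHom.ker φ).height + Nat.card ι := by
  induction σ using Finite.induction_empty_option with
  | @of_equiv α β e ih =>
    intro φ
    obtain ⟨ι, hι, y, hy, hyr, hc⟩ := ih (φ.comp (MvPolynomial.renameEquiv K e).toAlgHom)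
    refine ⟨ι, hι, y, hy, fun i => ?_, ?_⟩
    · obtain ⟨p, hp⟩ := hyr i
      exact ⟨_, hp⟩
    · rw [← Nat.card_congr e]
      refine hc.trans_eq ?_
      congr 1
      exact RingEquiv.height_comap (MvPolynomial.renameEquiv K e).toRingEquiv (RingHom.ker φ)
  | h_empty =>
    intro φ
    exact ⟨Empty, inferInstance, Empty.elim, algebraicIndependent_empty_type_iff.2
      (algebraMap K L).injective, fun i => i.elim, by simp⟩
  | @h_option α _ ih =>
    intro φ
    let e := MvPolynomial.optionEquivLeft K α
    let ψ : (MvPolynomial α K)[X] →ₐ[K] L := φ.comp e.symm.toAlgHom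
    let φ' : MvPolynomial α K →ₐ[K] L := ψ.comp (IsScalarTower.toAlgHom K _ _)
    obtain ⟨ι, hι, y, hy, hyr, hc⟩ := ih φ'
    have hφ' : ∀ x, φ' x = ψ (C x) := fun x => rfl
    have hht : (RingHom.ker φ).height = (RingHom.ker ψ).height :=
      (RingEquiv.height_comap e.symm.toRingEquiv (RingHom.ker φ)).symm
    have hrange : φ'.range ≤ φ.range := by
      rintro _ ⟨p, rfl⟩
      exact ⟨e.symm (C p), rfl⟩
    have hprime : (RingHom.ker φ').IsPrime := RingHom.ker_isPrime _
    have hprime' : (RingHom.ker ψ).IsPrime := RingHom.ker_isPrime _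
    have hPQ : (RingHom.ker φ').map C ≤ RingHom.ker ψ := by
      rw [Ideal.map_le_iff_le_comap]
      intro x hx
      exact hx
    have hcard : (Nat.card (Option α) : ℕ∞) = Nat.card α + 1 := by
      rw [Finite.card_option]; rfl
    by_cases htr : Transcendental φ'.range (ψ X)
    · have hle : Algebra.adjoin K (Set.range y) ≤ φ'.range :=
        Algebra.adjoin_le (by rintro _ ⟨i, rfl⟩; exact hyr i)
      have htr' : Transcendental (Algebra.adjoin K (Set.range y)) (ψ X) := by
        rw [transcendental_iff] at htr ⊢
        intro p hp
        have h := htr (p.map (Subalgebra.inclusion hle).toRingHom) (by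
          rw [aeval_def, eval₂_map]
          exact hp)
        exact (Polynomial.map_eq_zero_iff (Subalgebra.inclusion_injective hle)).1 h
      refine ⟨Option ι, inferInstance, fun o => o.elim (ψ X) y,
        (hy.option_iff_transcendental _).2 htr', ?_, ?_⟩
      · rintro (_ | i)
        · exact ⟨e.symm X, rfl⟩
        · exact hrange (hyr i)
      · rw [hcard, Finite.card_option, hht]
        push_cast
        rw [← add_assoc]
        gcongr
        exact hc.trans (add_le_add_left ((height_le_height_map_C _).trans (Ideal.height_mono hPQ)) _)
    -- An algebraic relation of `ψ X` over the earlier image lifts to an element of `ker ψ` outside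
    -- the extension of `ker φ'`, so the height grows by at least one.
    · refine ⟨ι, hι, y, hy, fun i => hrange (hyr i), ?_⟩
      rw [transcendental_iff] at htr
      push Not at htr
      obtain ⟨p, hp, hp0⟩ := htr
      obtain ⟨p', rfl⟩ := Polynomial.map_surjective φ'.rangeRestrict.toRingHom
        φ'.rangeRestrict_surjective p
      have hψ : ∀ q : (MvPolynomial α K)[X], ψ q = eval₂ φ'.toRingHom (ψ X) q := by
        intro q
        conv_lhs => rw [← eval₂_C_X (p := q)]
        rw [eval₂_eq_sum_range, eval₂_eq_sum_range, map_sum]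
        simp [hφ']
      have hmem : p' ∈ RingHom.ker ψ := by
        rw [RingHom.mem_ker, hψ, ← hp, aeval_def, eval₂_map]
        rfl
      have hlt : (RingHom.ker φ').map C < RingHom.ker ψ := by
        refine lt_of_le_of_ne hPQ fun h => hp0 ?_
        rw [← h, Ideal.mem_map_C_iff] at hmem
        ext m
        rw [coeff_map]
        exact congrArg _ (Subtype.ext (hmem m))
      have : ((RingHom.ker φ').map (C : _ →+* (MvPolynomial α K)[X])).IsPrime :=
        Ideal.isPrime_map_C_of_isPrime
      have h1 := Ideal.height_add_one_le_of_lt_of_isPrime hlt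
      rw [hcard, hht]
      calc (Nat.card α : ℕ∞) + 1 ≤ (RingHom.ker φ').height + Nat.card ι + 1 := by gcongr
        _ ≤ ((RingHom.ker φ').map C).height + 1 + Nat.card ι := by
          rw [add_right_comm]
          gcongr
          exact height_le_height_map_C _
        _ ≤ _ := by gcongr

/-- If `y` is an algebraically independent family in the field generated by `t`, then it has at
most as many members as `t`. -/
theorem card_le_of_algebraicIndependent_of_mem_adjoin {ι τ : Type} [Finite ι] [Finite τ]
    {y : ι → L} (hy : AlgebraicIndependent K y) {t : τ → L}
    (h : ∀ i, y i ∈ IntermediateField.adjoin K (Set.range t)) : Nat.card ι ≤ Nat.card τ := by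
  let E := IntermediateField.adjoin K (Set.range t)
  let t' : τ → E := fun i => ⟨t i, IntermediateField.subset_adjoin K _ ⟨i, rfl⟩⟩
  let y' : ι → E := fun i => ⟨y i, h i⟩
  have hy' : AlgebraicIndependent K y' := AlgebraicIndependent.of_comp E.val hy
  -- Elements of `E` are quotients of polynomials in `t`, so the transcendence degree of `E` is at
  -- most the number of generators.
  have halg : Algebra.IsAlgebraic (Algebra.adjoin K (Set.range t')) E := by
    refine ⟨fun x => ?_⟩
    obtain ⟨r, s, hx⟩ := (IntermediateField.mem_adjoin_range_iff K t x.1).1 x.2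
    have hmem : ∀ r : MvPolynomial τ K, MvPolynomial.aeval t' r ∈
        Algebra.adjoin K (Set.range t') := fun r => by
      rw [Algebra.adjoin_range_eq_range_aeval]; exact ⟨r, rfl⟩
    have hval : ∀ r : MvPolynomial τ K, ((MvPolynomial.aeval t' r : E) : L) =
        MvPolynomial.aeval t r := fun r => by
      rw [← IntermediateField.coe_val, MvPolynomial.comp_aeval_apply]
      rfl
    have hx' : x = MvPolynomial.aeval t' r * (MvPolynomial.aeval t' s)⁻¹ := by
      apply Subtype.ext
      rw [hx, div_eq_mul_inv]
      simp [hval]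
    rw [hx']
    exact (isAlgebraic_algebraMap (⟨_, hmem r⟩ : Algebra.adjoin K (Set.range t'))).mul
      (isAlgebraic_algebraMap (⟨_, hmem s⟩ : Algebra.adjoin K (Set.range t'))).inv
  have h1 := hy'.lift_cardinalMk_le_trdeg
  have h2 := Algebra.IsAlgebraic.trdeg_le_cardinalMk K (Set.range t')
  have h3 := h1.trans (Cardinal.lift_le.2 h2)
  rw [← Nat.cast_card, ← Nat.cast_card, Cardinal.lift_natCast, Cardinal.lift_natCast,
    Nat.cast_le] at h3
  exact h3.trans (Finite.card_range_le t')

/-- The kernel of a homomorphism from a polynomial ring into a field generated over `K` by `τ`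
elements has height at least the number of variables minus the number of these elements. -/
theorem card_le_height_ker_add_card {σ τ : Type} [Finite σ] [Finite τ]
    (φ : MvPolynomial σ K →ₐ[K] L) (t : τ → L)
    (h : ∀ i, φ (MvPolynomial.X i) ∈ IntermediateField.adjoin K (Set.range t)) :
    (Nat.card σ : ℕ∞) ≤ (RingHom.ker φ).height + Nat.card τ := by
  obtain ⟨ι, hι, y, hy, hyr, hc⟩ := exists_algebraicIndependent_of_ker σ φ
  have hmem : ∀ p, φ p ∈ IntermediateField.adjoin K (Set.range t) := by
    intro p
    induction p using MvPolynomial.induction_on with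
    | C a =>
      rw [← MvPolynomial.algebraMap_eq, AlgHom.commutes]
      exact IntermediateField.algebraMap_mem _ a
    | add p q hp hq => rw [map_add]; exact add_mem hp hq
    | mul_X p i hp => rw [map_mul]; exact mul_mem hp (h i)
  have hcard : Nat.card ι ≤ Nat.card τ :=
    card_le_of_algebraicIndependent_of_mem_adjoin hy fun i => by
      obtain ⟨p, hp⟩ := hyr i
      rw [← hp]
      exact hmem p
  exact hc.trans (by gcongr)

end Dimension

/-! ### Taylor coefficients of a quotient and their specialisation -/

section TaylorQuotients

variable {R : Type*} [CommRing R] {l : ℕ} {n : Fin l → ℕ}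

/-- Isolating the term `t = 0` gives a triangular recursion: where `B` is invertible at the node, `v
i s` is determined by the earlier values. -/
theorem mul_eval_eq_of_defect_eq_zero {u : Fin l → R} {v : (i : Fin l) → Fin (n i) → R}
    {A B : R[X]} {i : Fin l} {s : Fin (n i)} (h : defect u v ⟨i, s⟩ (A, B) = 0) :
    v i s * B.eval (u i) = (taylor (u i) A).coeff s -
      ∑ t : Fin (s : ℕ), v i ⟨(s : ℕ) - (t + 1), lt_of_le_of_lt (Nat.sub_le _ _) s.isLt⟩ *
        (taylor (u i) B).coeff (t + 1) := by
  rw [defect_apply, sub_eq_zero, Fin.sum_univ_succ] at h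
  rw [← taylor_coeff_zero]
  simp only [Fin.val_zero, Nat.sub_zero, Fin.val_succ] at h
  rw [h]
  ring

theorem Interpolates.eq_of_isUnit {u : Fin l → R} {v v' : (i : Fin l) → Fin (n i) → R}
    {A B : R[X]} (hB : ∀ i, IsUnit (B.eval (u i))) (h : Interpolates u v A B)
    (h' : Interpolates u v' A B) : v = v' := by
  rw [interpolates_iff_defect] at h h'
  funext i s
  obtain ⟨m, hm⟩ := s
  induction m using Nat.strong_induction_on with
  | _ m ih =>
    refine (hB i).mul_left_injective ?_
    dsimp only
    rw [mul_eval_eq_of_defect_eq_zero (h ⟨i, ⟨m, hm⟩⟩),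
      mul_eval_eq_of_defect_eq_zero (h' ⟨i, ⟨m, hm⟩⟩)]
    congr 1
    refine Finset.sum_congr rfl fun t _ => ?_
    congr 1
    exact ih _ (by have := t.isLt; dsimp only at this ⊢; omega) _

/-- The values are the coefficients of the power series quotient of the two Taylor expansions. -/
theorem exists_interpolates_of_isUnit {u : Fin l → R} {A B : R[X]}
    (hB : ∀ i, IsUnit (B.eval (u i))) :
    ∃ v : (i : Fin l) → Fin (n i) → R, Interpolates u v A B := by
  choose b hb using hB
  let V : Fin l → PowerSeries R := fun i =>
    (taylor (u i) A : PowerSeries R) * PowerSeries.invOfUnit (taylor (u i) B) (b i)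
  have hV : ∀ i, (taylor (u i) A : PowerSeries R) = (taylor (u i) B : PowerSeries R) * V i := by
    intro i
    have := PowerSeries.mul_invOfUnit (taylor (u i) B : PowerSeries R) (b i) (by
      rw [hb, ← taylor_coeff_zero, ← Polynomial.coeff_coe, PowerSeries.coeff_zero_eq_constantCoeff])
    rw [mul_left_comm, this, mul_one]
  refine ⟨fun i s => PowerSeries.coeff (s : ℕ) (V i), ?_⟩
  rw [interpolates_iff_defect]
  rintro ⟨i, s⟩
  rw [defect_apply, sub_eq_zero, ← Polynomial.coeff_coe, hV i, PowerSeries.coeff_mul,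
    Finset.Nat.sum_antidiagonal_eq_sum_range_succ_mk, Finset.sum_range]
  refine Finset.sum_congr rfl fun t _ => ?_
  rw [mul_comm, Polynomial.coeff_coe]

/-- Relations between the Taylor coefficients of a generic quotient specialise. -/
theorem aeval_eq_zero_of_specialization {K S F L : Type*} [Field K] [CommRing S] [IsDomain S]
    [Algebra K S] [Field F] [Algebra S F] [IsFractionRing S F] [Algebra K F] [IsScalarTower K S F]
    [Field L] [Algebra K L] (h : S →ₐ[K] L) {u : Fin l → S} {A B : S[X]}
    (hB : ∀ i, h (B.eval (u i)) ≠ 0) {vF : (i : Fin l) → Fin (n i) → F}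
    {vL : (i : Fin l) → Fin (n i) → L}
    (hF : Interpolates (fun i => algebraMap S F (u i)) vF (A.map (algebraMap S F))
      (B.map (algebraMap S F)))
    (hL : Interpolates (fun i => h (u i)) vL (A.map h.toRingHom) (B.map h.toRingHom))
    {f : MvPolynomial (Params n) K}
    (hf : MvPolynomial.aeval (dataPoint (fun i => algebraMap S F (u i)) vF) f = 0) :
    MvPolynomial.aeval (dataPoint (fun i => h (u i)) vL) f = 0 := by
  -- `T` inverts exactly what `h` does not kill. It embeds in `F`, maps to `L`, and contains the
  -- Taylor coefficients of the quotient; by uniqueness both `vF` and `vL` are images of these, so a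
  -- relation in `F` holds in `T` and passes to `L`.
  let M : Submonoid S := (nonZeroDivisors L).comap h
  have hM : M ≤ nonZeroDivisors S := by
    intro s hs
    rw [mem_nonZeroDivisors_iff_ne_zero]
    rintro rfl
    exact nonZeroDivisors.ne_zero hs (map_zero h)
  let T := Localization M
  let toL : T →ₐ[K] L := IsLocalization.liftAlgHom (M := M) (f := h)
    fun y => (nonZeroDivisors.ne_zero y.2).isUnit
  let toF : T →ₐ[K] F := IsLocalization.liftAlgHom (M := M) (f := IsScalarTower.toAlgHom K S F)
    fun y => (IsFractionRing.to_map_ne_zero_of_mem_nonZeroDivisors (hM y.2)).isUnit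
  have hinj : Function.Injective toF := by
    have := (IsLocalization.lift_injective_iff (M := M) (S := T) (g := algebraMap S F)
      (fun y => (IsFractionRing.to_map_ne_zero_of_mem_nonZeroDivisors (hM y.2)).isUnit)).2
      fun x y => by
        rw [(IsLocalization.injective T hM).eq_iff, (IsFractionRing.injective S F).eq_iff]
    exact this
  have htoL : ∀ s, toL (algebraMap S T s) = h s := fun s => IsLocalization.lift_eq _ s
  have htoF : ∀ s, toF (algebraMap S T s) = algebraMap S F s := fun s => IsLocalization.lift_eq _ s
  have hcL : toL.toRingHom.comp (algebraMap S T) = h.toRingHom := RingHom.ext htoL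
  have hcF : toF.toRingHom.comp (algebraMap S T) = algebraMap S F := RingHom.ext htoF
  have hunit : ∀ i, IsUnit ((B.map (algebraMap S T)).eval (algebraMap S T (u i))) := by
    intro i
    rw [eval_map_apply]
    exact IsLocalization.map_units T (⟨_, mem_nonZeroDivisors_of_ne_zero (hB i)⟩ : M)
  obtain ⟨vT, hT⟩ := exists_interpolates_of_isUnit (n := n) (A := A.map (algebraMap S T)) hunit
  have hTF := hT.map toF.toRingHom
  have hTL := hT.map toL.toRingHom
  rw [Polynomial.map_map, Polynomial.map_map, hcF] at hTF
  rw [Polynomial.map_map, Polynomial.map_map, hcL] at hTL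
  have huF : (fun i => toF.toRingHom (algebraMap S T (u i))) = fun i => algebraMap S F (u i) :=
    funext fun i => htoF _
  have huL : (fun i => toL.toRingHom (algebraMap S T (u i))) = fun i => h (u i) :=
    funext fun i => htoL _
  rw [huF] at hTF
  rw [huL] at hTL
  have hvF : vF = fun i s => toF.toRingHom (vT i s) := by
    refine hF.eq_of_isUnit (fun i => ?_) hTF
    rw [eval_map_apply, ← htoF, ← eval_map_apply]
    exact (hunit i).map toF
  have hvL : vL = fun i s => toL.toRingHom (vT i s) := by
    refine hL.eq_of_isUnit (fun i => ?_) hTL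
    have := (hB i).isUnit
    rwa [← AlgHom.coe_toRingHom, ← eval_map_apply] at this
  have hxF : dataPoint (fun i => algebraMap S F (u i)) vF =
      fun i => toF (dataPoint (fun i => algebraMap S T (u i)) vT i) := by
    funext i
    rcases i with i | ⟨i, s⟩
    · exact (htoF _).symm
    · simp only [dataPoint, Sum.elim_inr, hvF]; rfl
  have hxL : dataPoint (fun i => h (u i)) vL =
      fun i => toL (dataPoint (fun i => algebraMap S T (u i)) vT i) := by
    funext i
    rcases i with i | ⟨i, s⟩
    · exact (htoL _).symm
    · simp only [dataPoint, Sum.elim_inr, hvL]; rfl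
  rw [hxF, ← MvPolynomial.comp_aeval_apply] at hf
  rw [hxL, ← MvPolynomial.comp_aeval_apply, (map_eq_zero_iff toF hinj).1 hf, map_zero]

end TaylorQuotients

/-! ### Counting generators of the field of a data point -/

section Generation

variable {K : Type*} [Field K] {L : Type*} [Field L] [Algebra K L] {l : ℕ} {n : Fin l → ℕ}

theorem taylor_coeff_mem {E : IntermediateField K L} {f : L[X]} {r : L} (hr : r ∈ E)
    (hf : ∀ m, f.coeff m ∈ E) (m : ℕ) : (taylor r f).coeff m ∈ E := by
  obtain ⟨f', rfl⟩ : ∃ f' : E[X], f'.map (algebraMap E L) = f := by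
    have := (lifts_iff_coeff_lifts (f := algebraMap E L) f).2 fun m => ⟨⟨_, hf m⟩, rfl⟩
    exact (mem_lifts f).1 this
  have : (taylor (algebraMap E L ⟨r, hr⟩) (f'.map (algebraMap E L))).coeff m ∈ E := by
    rw [← map_taylor, coeff_map]
    exact Subtype.mem _
  exact this

/-- The first `m i` values at a node follow from the recursion by division by `B (u i)`; the other
`n i - m i` are adjoined. The leading coefficient of `B` is `1` and costs nothing. -/
theorem exists_generators_of_eval_ne_zero {u : Fin l → L} {v : (i : Fin l) → Fin (n i) → L}
    {m : Fin l → ℕ} {a : ℕ} {A B : L[X]} (hA : A.degree < a) (hB : B.Monic)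
    (h : ∀ i, (X - C (u i)) ^ m i ∣ A - localInterpolant u v i * B)
    (h0 : ∀ i, 0 < m i → B.eval (u i) ≠ 0) :
    ∃ (τ : Type) (_ : Finite τ) (t : τ → L),
      Nat.card τ ≤ l + a + B.natDegree + ∑ i, (n i - m i) ∧
        ∀ i, dataPoint u v i ∈ IntermediateField.adjoin K (Set.range t) := by
  let vv : (i : Fin l) → ℕ → L := fun i s => if hs : s < n i then v i ⟨s, hs⟩ else 0
  let t : (Fin l ⊕ Fin a) ⊕ (Fin B.natDegree ⊕ Σ i, Fin (n i - m i)) → L :=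
    Sum.elim (Sum.elim u fun j => A.coeff j) (Sum.elim (fun j => B.coeff j)
      fun r => vv r.1 (m r.1 + r.2))
  refine ⟨_, inferInstance, t, ?_, ?_⟩
  · simp [add_assoc]
  set E := IntermediateField.adjoin K (Set.range t)
  have hmem : ∀ i, t i ∈ E := fun i => IntermediateField.subset_adjoin K _ ⟨i, rfl⟩
  have hu : ∀ i, u i ∈ E := fun i => hmem (Sum.inl (Sum.inl i))
  have hAE : ∀ j, A.coeff j ∈ E := by
    intro j
    rcases lt_or_ge j a with hj | hj
    · exact hmem (Sum.inl (Sum.inr ⟨j, hj⟩))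
    · rw [coeff_eq_zero_of_degree_lt (hA.trans_le (by exact_mod_cast hj))]
      exact E.zero_mem
  have hBE : ∀ j, B.coeff j ∈ E := by
    intro j
    rcases lt_trichotomy j B.natDegree with hj | rfl | hj
    · exact hmem (Sum.inr (Sum.inl ⟨j, hj⟩))
    · rw [hB.coeff_natDegree]
      exact E.one_mem
    · rw [coeff_eq_zero_of_natDegree_lt hj]
      exact E.zero_mem
  have hv : ∀ i (s : ℕ) (hs : s < n i), v i ⟨s, hs⟩ ∈ E := by
    intro i s
    induction s using Nat.strong_induction_on with
    | _ s ih =>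
      intro hs
      rcases lt_or_ge s (m i) with hm | hm
      · have hd : defect u v ⟨i, ⟨s, hs⟩⟩ (A, B) = 0 := by
          rw [defect_eq_coeff]
          exact (X_sub_C_pow_dvd_iff_taylor _ _ _).1 (h i) s hm
        have hb := h0 i (by omega)
        rw [eq_div_of_mul_eq hb (mul_eval_eq_of_defect_eq_zero hd)]
        refine E.div_mem (E.sub_mem (taylor_coeff_mem (hu i) hAE _) (E.sum_mem fun t _ => ?_)) ?_
        · exact E.mul_mem (ih _ (by have := t.isLt; dsimp only at this ⊢; omega) _)
            (taylor_coeff_mem (hu i) hBE _)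
        · rw [← taylor_coeff_zero]
          exact taylor_coeff_mem (hu i) hBE _
      · have := hmem (Sum.inr (Sum.inr ⟨i, ⟨s - m i, by omega⟩⟩))
        simpa [t, vv, Nat.add_sub_cancel' hm, hs] using this
  rintro (i | ⟨i, s⟩)
  · exact hu i
  · exact hv i s s.isLt

/-- A zero of `B` at a constrained node is also a zero of `A`. Cancelling it costs one condition at
that node and none elsewhere, by coprimality. -/
theorem exists_div_X_sub_C {u : Fin l → L} (hu : Function.Injective u)
    {v : (i : Fin l) → Fin (n i) → L} {m : Fin l → ℕ} {a : ℕ} {A B : L[X]} (hA : A.degree < a)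
    (hB : B.Monic) (h : ∀ i, (X - C (u i)) ^ m i ∣ A - localInterpolant u v i * B) {i : Fin l}
    (hi : 0 < m i) (h0 : B.eval (u i) = 0) :
    ∃ A' B' : L[X], A'.degree < ((a - 1 : ℕ) : WithBot ℕ) ∧ B'.Monic ∧
      B.natDegree = B'.natDegree + 1 ∧ ∀ i', (X - C (u i')) ^ (Function.update m i (m i - 1) i') ∣
        A' - localInterpolant u v i' * B' := by
  obtain ⟨B', rfl⟩ := dvd_iff_isRoot.2 h0
  have hXA : X - C (u i) ∣ A := by
    have h1 := (dvd_pow_self (X - C (u i)) hi.ne').trans (h i)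
    have h2 : X - C (u i) ∣ localInterpolant u v i * ((X - C (u i)) * B') :=
      (dvd_mul_right _ _).mul_left _
    simpa using dvd_add h1 h2
  obtain ⟨A', rfl⟩ := hXA
  have hB' : B'.Monic := (monic_X_sub_C (u i)).of_mul_monic_left hB
  have hfac : ∀ i', (X - C (u i)) * A' - localInterpolant u v i' * ((X - C (u i)) * B') =
      (X - C (u i)) * (A' - localInterpolant u v i' * B') := fun i' => by ring
  refine ⟨A', B', ?_, hB', ?_, fun i' => ?_⟩
  · rwa [mul_comm, degree_mul_lt_iff (X_sub_C_ne_zero _), natDegree_X_sub_C] at hA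
  · rw [natDegree_mul (X_sub_C_ne_zero _) hB'.ne_zero, natDegree_X_sub_C, add_comm]
  · have hd := h i'
    rw [hfac] at hd
    rcases eq_or_ne i' i with rfl | hii
    · rw [Function.update_self]
      obtain ⟨m', hm'⟩ : ∃ m', m i' = m' + 1 := ⟨m i' - 1, by omega⟩
      rw [hm', pow_succ'] at hd
      rw [hm', Nat.add_sub_cancel]
      exact (mul_dvd_mul_iff_left (X_sub_C_ne_zero _)).1 hd
    · rw [Function.update_of_ne hii]
      exact IsCoprime.dvd_of_dvd_mul_left (pairwise_coprime_X_sub_C hu hii).pow_left hd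

theorem sum_sub_update {m : Fin l → ℕ} {i : Fin l} (hi : 0 < m i) (hm : m i ≤ n i) :
    ∑ i', (n i' - Function.update m i (m i - 1) i') = ∑ i', (n i' - m i') + 1 := by
  rw [← Finset.add_sum_erase _ _ (Finset.mem_univ i),
    ← Finset.add_sum_erase (a := i) _ (fun i' => n i' - m i') (Finset.mem_univ i),
    Function.update_self, Finset.sum_congr rfl fun i' hi' => by
      rw [Function.update_of_ne (Finset.ne_of_mem_erase hi')]]
  omega

/-- The data of a point with a given solution of the interpolation problem generate a field which
is generated by the nodes, the coefficients of the solution and the unconstrained values. -/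
theorem exists_generators_of_pow_dvd {u : Fin l → L} (hu : Function.Injective u)
    (v : (i : Fin l) → Fin (n i) → L) {m : Fin l → ℕ} (hm : ∀ i, m i ≤ n i) {a : ℕ} {A B : L[X]}
    (hA : A.degree < a) (hB : B.Monic)
    (h : ∀ i, (X - C (u i)) ^ m i ∣ A - localInterpolant u v i * B) :
    ∃ (τ : Type) (_ : Finite τ) (t : τ → L),
      Nat.card τ ≤ l + a + B.natDegree + ∑ i, (n i - m i) ∧
        ∀ i, dataPoint u v i ∈ IntermediateField.adjoin K (Set.range t) := by
  induction hb : B.natDegree generalizing m a A B with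
  | zero =>
    rw [← hb]
    refine exists_generators_of_eval_ne_zero hA hB h fun i _ => ?_
    rw [hB.natDegree_eq_zero.1 hb]
    simp
  | succ b ih =>
    by_cases hex : ∃ i, 0 < m i ∧ B.eval (u i) = 0
    · obtain ⟨i, hi, h0⟩ := hex
      obtain ⟨A', B', hA', hB', hdeg, h'⟩ := exists_div_X_sub_C hu hA hB h hi h0
      obtain ⟨τ, hτ, t, hc, ht⟩ := ih (fun i' => by
        rcases eq_or_ne i' i with rfl | hii
        · rw [Function.update_self]; exact (Nat.sub_le _ _).trans (hm _)
        · rw [Function.update_of_ne hii]; exact hm _) hA' hB' h' (by omega)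
      rw [sum_sub_update hi (hm i)] at hc
      exact ⟨τ, hτ, t, by omega, ht⟩
    · push Not at hex
      rw [← hb]
      exact exists_generators_of_eval_ne_zero hA hB h hex

/-- Common zeros of a solution at the nodes, or a drop of the degree of the denominator, decrease
the number of generators. -/
theorem Interpolates.exists_generators_lt {u : Fin l → L} (hu : Function.Injective u)
    {v : (i : Fin l) → Fin (n i) → L} (hn : ∀ i, 0 < n i) {α β : ℕ} {A B : L[X]}
    (hA : A.degree < ((α + 1 : ℕ) : WithBot ℕ)) (hB : B.Monic) (hBβ : B.natDegree ≤ β)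
    (h : Interpolates u v A B) (hbad : B.natDegree ≠ β ∨ ∃ i, B.eval (u i) = 0) :
    ∃ (τ : Type) (_ : Finite τ) (t : τ → L), Nat.card τ < l + (α + 1) + β ∧
        ∀ i, dataPoint u v i ∈ IntermediateField.adjoin K (Set.range t) := by
  by_cases hdeg : B.natDegree = β
  · obtain ⟨i, h0⟩ := hbad.resolve_left (not_not.2 hdeg)
    obtain ⟨A', B', hA', hB', hdeg', h'⟩ := exists_div_X_sub_C hu hA hB h (hn i) h0
    obtain ⟨τ, hτ, t, hc, ht⟩ := exists_generators_of_pow_dvd (K := K) hu v (fun i' => by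
        rcases eq_or_ne i' i with rfl | hii
        · rw [Function.update_self]; exact (Nat.sub_le _ _)
        · rw [Function.update_of_ne hii]) hA' hB' h'
    rw [sum_sub_update (hn i) le_rfl] at hc
    simp only [Nat.sub_self, Finset.sum_const_zero] at hc
    -- Cancelling a common zero removes two coefficients and frees one value, a net loss of one
    -- generator.
    exact ⟨τ, hτ, t, by omega, ht⟩
  · obtain ⟨τ, hτ, t, hc, ht⟩ :=
      exists_generators_of_pow_dvd (K := K) hu v (fun i => le_refl (n i)) hA hB h
    simp only [Nat.sub_self, Finset.sum_const_zero] at hc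
    exact ⟨τ, hτ, t, by omega, ht⟩

end Generation

/-! ### The locus in terms of monic denominators -/

section Monic

theorem natDegree_lt_of_degree_lt {R : Type*} [Semiring R] {f : R[X]} {m : ℕ}
    (h : f.degree < ((m + 1 : ℕ) : WithBot ℕ)) : f.natDegree < m + 1 :=
  Nat.lt_succ_iff.2 (natDegree_le_iff_degree_le.2 ((degree_le_iff_degree_lt rfl).2 h))

variable {F : Type*} [Field F] {l : ℕ} {n : Fin l → ℕ} {u : Fin l → F}
  {v : (i : Fin l) → Fin (n i) → F}

/-- Normalise the generator in one direction; in the other, the given pair is a nonzero multiple of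
the generator, which therefore obeys the same bounds. Valid over any field, it is applied to the
generic field, to the subfield generated by the coordinates, and to residue fields of minimal
primes. -/
theorem minors_eq_zero_iff_exists_monic (hu : Function.Injective u) {k j α β : ℕ}
    (hα : α = k - j) (hβ : β = ∑ i, n i + 1 - k - j) (hj : 1 ≤ j)
    (hjk : j ≤ k) (hkN : k ≤ ∑ i, n i) (hjN : k + j ≤ ∑ i, n i + 1) :
    (∀ a ∈ Finset.Icc (k - j + 2) (k + j - 1), signedMinor u v a a = 0) ↔
      ∃ A B : F[X], A.degree < ((α + 1 : ℕ) : WithBot ℕ) ∧ B.Monic ∧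
        B.natDegree ≤ β ∧ Interpolates u v A B := by
  subst hα hβ
  obtain ⟨g, hg⟩ := exists_isGenerator hu v hkN
  rw [← hg.mem_solutions_iff_minors hu hj hjk hjN]
  constructor
  · intro h
    have hc : g.2.leadingCoeff⁻¹ ≠ 0 := inv_ne_zero (leadingCoeff_ne_zero.2 hg.snd_ne_zero)
    rw [mem_solutions] at h
    refine ⟨C g.2.leadingCoeff⁻¹ * g.1, C g.2.leadingCoeff⁻¹ * g.2, ?_, ?_, ?_, ?_⟩
    · rw [degree_C_mul hc, show k - j + 1 = k + 1 - j by omega]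
      exact h.1
    · rw [mul_comm]
      exact monic_mul_leadingCoeff_inv hg.snd_ne_zero
    · rw [natDegree_C_mul hc]
      have := (natDegree_lt_iff_degree_lt hg.snd_ne_zero).2 h.2.1
      omega
    · exact (interpolatesSubmodule u v).smul_mem (C g.2.leadingCoeff⁻¹) (x := g) h.2.2
  · rintro ⟨A, B, hA, hB, hBd, hI⟩
    have hmem : (A, B) ∈ solutions u v (k + 1 - j) (∑ i, n i + 2 - k - j) := by
      rw [mem_solutions]
      refine ⟨hA.trans_le (by exact_mod_cast (by omega : k - j + 1 ≤ k + 1 - j)), ?_, hI⟩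
      rw [← natDegree_lt_iff_degree_lt hB.ne_zero]
      omega
    obtain ⟨q, hq⟩ := hg.exists_smul_eq_of_mem hu hg.mem hmem (by omega) (by omega)
    have h1 : A = q * g.1 := congrArg Prod.fst hq
    have h2 : B = q * g.2 := congrArg Prod.snd hq
    have hq0 : q ≠ 0 := by
      rintro rfl
      exact hB.ne_zero (by simpa using h2)
    rw [mem_solutions] at hmem ⊢
    refine ⟨?_, ?_, (mem_solutions.1 hg.mem).2.2⟩
    · refine (degree_le_mul_left g.1 hq0).trans_lt ?_
      rw [mul_comm, ← h1]
      exact hmem.1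
    · refine (degree_le_mul_left g.2 hq0).trans_lt ?_
      rw [mul_comm, ← h2]
      exact hmem.2.1

end Monic

/-! ### The generic numerator and denominator -/

section Generic

/-- The indices of the nodes and of the coefficients of a polynomial of degree at most `α` and of
a monic polynomial of degree `β`. -/
abbrev GenericVars (l α β : ℕ) : Type := Fin l ⊕ (Fin (α + 1) ⊕ Fin β)

variable (K : Type*) [Field K] (l α β : ℕ)

/-- The coordinate ring of the nodes and the coefficients of numerator and denominator. -/
abbrev GenericRing : Type _ := MvPolynomial (GenericVars l α β) K

/-- The field of fractions of the generic coordinate ring. -/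
abbrev GenericField : Type _ := FractionRing (GenericRing K l α β)

/-- The generic numerator of degree `α`. -/
noncomputable def genericNum : (GenericRing K l α β)[X] :=
  ∑ j : Fin (α + 1), C (MvPolynomial.X (Sum.inr (Sum.inl j))) * X ^ (j : ℕ)

/-- The generic monic denominator of degree `β`. -/
noncomputable def genericDen : (GenericRing K l α β)[X] :=
  X ^ β + ∑ j : Fin β, C (MvPolynomial.X (Sum.inr (Sum.inr j))) * X ^ (j : ℕ)

/-- The generic node. -/
noncomputable def genericNode (i : Fin l) : GenericRing K l α β := MvPolynomial.X (Sum.inl i)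

theorem genericDen_monic : (genericDen K l α β).Monic :=
  monic_X_pow_add (degree_sum_fin_lt _)

theorem natDegree_genericDen : (genericDen K l α β).natDegree = β := by
  rw [genericDen, natDegree_add_eq_left_of_degree_lt, natDegree_X_pow]
  rw [degree_X_pow]
  exact degree_sum_fin_lt _

theorem degree_genericNum_lt : (genericNum K l α β).degree < ((α + 1 : ℕ) : WithBot ℕ) :=
  degree_sum_fin_lt _

theorem genericNum_coeff (j : Fin (α + 1)) :
    (genericNum K l α β).coeff j = MvPolynomial.X (Sum.inr (Sum.inl j)) := by
  rw [genericNum, finsetSum_coeff, Finset.sum_eq_single j]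
  · simp
  · intro b _ hb
    simp [coeff_X_pow, Fin.val_ne_of_ne hb.symm]
  · simp

theorem genericDen_coeff (j : Fin β) :
    (genericDen K l α β).coeff j = MvPolynomial.X (Sum.inr (Sum.inr j)) := by
  rw [genericDen, coeff_add, coeff_X_pow, if_neg j.isLt.ne, zero_add, finsetSum_coeff,
    Finset.sum_eq_single j]
  · simp
  · intro b _ hb
    simp [coeff_X_pow, Fin.val_ne_of_ne hb.symm]
  · simp

variable {K l α β}

/-- The specialisation at the given nodes, numerator and denominator. -/
noncomputable def specialize {L : Type*} [Field L] [Algebra K L] (u : Fin l → L) (A B : L[X]) :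
    GenericRing K l α β →ₐ[K] L :=
  MvPolynomial.aeval (Sum.elim u (Sum.elim (fun j => A.coeff j) fun j => B.coeff j))

section Specialize

variable {L : Type*} [Field L] [Algebra K L] (u : Fin l → L)

theorem specialize_genericNode (A B : L[X]) (i : Fin l) :
    specialize u A B (genericNode K l α β i) = u i := by
  simp [specialize, genericNode]

theorem map_specialize_genericNum {A : L[X]} (hA : A.degree < ((α + 1 : ℕ) : WithBot ℕ))
    (B : L[X]) : (genericNum K l α β).map (specialize u A B).toRingHom = A := by
  have hA' := natDegree_lt_of_degree_lt hA
  conv_rhs => rw [A.as_sum_range_C_mul_X_pow' hA', Finset.sum_range]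
  rw [genericNum, Polynomial.map_sum]
  refine Finset.sum_congr rfl fun j _ => ?_
  simp [specialize]

theorem map_specialize_genericDen (A : L[X]) {B : L[X]} (hB : B.Monic) (hβ : B.natDegree = β) :
    (genericDen K l α β).map (specialize u A B).toRingHom = B := by
  conv_rhs => rw [hB.as_sum, Finset.sum_range, hβ]
  rw [genericDen, Polynomial.map_add, Polynomial.map_pow, map_X, Polynomial.map_sum]
  congr 1
  refine Finset.sum_congr rfl fun j _ => ?_
  simp [specialize]

end Specialize

/-- Specialise the denominator to `X^β` and the nodes to `1`: the value becomes `1`. -/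
theorem eval_genericDen_ne_zero (i : Fin l) :
    (genericDen K l α β).eval (genericNode K l α β i) ≠ 0 := by
  intro h
  have h1 := map_specialize_genericDen (K := K) (α := α) (l := l) (fun _ => (1 : K)) 1
    (monic_X_pow β) (natDegree_X_pow β)
  have h2 := congrArg (specialize (K := K) (fun _ => (1 : K)) (1 : K[X]) (X ^ β)).toRingHom h
  rw [← eval_map_apply, h1] at h2
  have h3 := specialize_genericNode (K := K) (α := α) (β := β) (fun _ => (1 : K)) 1 (X ^ β) i
  rw [map_zero] at h2
  erw [h3] at h2
  simp at h2

/-- The resultant lies in the ideal of the two polynomials, and it is nonzero since it specialises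
to a sign at numerator `1` and denominator `X^β`. For `β = 0` the denominator is `1`. -/
theorem isCoprime_generic (F : Type*) [Field F] [Algebra (GenericRing K l α β) F]
    [IsFractionRing (GenericRing K l α β) F] :
    IsCoprime ((genericNum K l α β).map (algebraMap _ F))
      ((genericDen K l α β).map (algebraMap _ F)) := by
  rcases Nat.eq_zero_or_pos β with rfl | hβ
  · rw [(genericDen_monic K l α 0).natDegree_eq_zero.1 (natDegree_genericDen K l α 0),
      Polynomial.map_one]
    exact isCoprime_one_right
  have hne : resultant (genericNum K l α β) (genericDen K l α β) α β ≠ 0 := by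
    intro h
    have h1 := map_specialize_genericDen (K := K) (α := α) (l := l) (fun _ => (1 : K)) 1
      (monic_X_pow β) (natDegree_X_pow β)
    have h2 := map_specialize_genericNum (K := K) (α := α) (l := l) (β := β) (fun _ => (1 : K))
      (A := 1) (by rw [degree_one]; exact_mod_cast Nat.succ_pos α) (X ^ β)
    have h3 := resultant_map_map (genericNum K l α β) (genericDen K l α β) α β
      (specialize (K := K) (fun _ => (1 : K)) (1 : K[X]) (X ^ β)).toRingHom
    rw [h, h1, h2, map_zero, resultant_one_left, coeff_X_pow_self, one_pow, mul_one] at h3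
    exact pow_ne_zero _ (neg_ne_zero.2 one_ne_zero) h3
  obtain ⟨p, q, -, -, h⟩ := exists_mul_add_mul_eq_C_resultant (m := α) (n := β)
    (genericNum K l α β) (genericDen K l α β)
    (Nat.lt_succ_iff.1 (natDegree_lt_of_degree_lt (degree_genericNum_lt K l α β)))
    (natDegree_genericDen K l α β).le (Or.inr hβ.ne')
  set r := resultant (genericNum K l α β) (genericDen K l α β) α β
  have hr : algebraMap (GenericRing K l α β) F r ≠ 0 :=
    (map_ne_zero_iff _ (IsFractionRing.injective _ F)).2 hne
  have h' := congrArg (Polynomial.map (algebraMap (GenericRing K l α β) F)) h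
  rw [Polynomial.map_add, Polynomial.map_mul, Polynomial.map_mul, map_C] at h'
  refine ⟨C (algebraMap _ F r)⁻¹ * p.map (algebraMap _ F),
    C (algebraMap _ F r)⁻¹ * q.map (algebraMap _ F), ?_⟩
  have h1 : (C (algebraMap _ F r)⁻¹ : F[X]) * C (algebraMap _ F r) = 1 := by
    rw [← C_mul, inv_mul_cancel₀ hr, C_1]
  linear_combination (C (algebraMap _ F r)⁻¹ : F[X]) * h' + h1

end Generic

/-! ### The generic point, its height bound and its function field -/

section GenericPoint

variable {K : Type*} [Field K] {l : ℕ} {n : Fin l → ℕ} {α β : ℕ}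

/-- The generic point with the values of the generic quotient: `x` has the generic nodes as node
coordinates, and its values are interpolated by the generic numerator and denominator. -/
structure IsGenericPoint (K : Type*) [Field K] {l : ℕ} {n : Fin l → ℕ} (α β : ℕ)
    (v : (i : Fin l) → Fin (n i) → GenericField K l α β) : Prop where
  interpolates : Interpolates (fun i => algebraMap _ (GenericField K l α β)
      (genericNode K l α β i)) v
    ((genericNum K l α β).map (algebraMap _ _)) ((genericDen K l α β).map (algebraMap _ _))

theorem exists_isGenericPoint (K : Type*) [Field K] {l : ℕ} (n : Fin l → ℕ) (α β : ℕ) :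
    ∃ v, IsGenericPoint K (n := n) α β v := by
  obtain ⟨v, hv⟩ := exists_interpolates_of_isUnit (n := n)
    (R := GenericField K l α β)
    (u := fun i => algebraMap _ (GenericField K l α β) (genericNode K l α β i))
    (A := (genericNum K l α β).map (algebraMap _ _))
    (B := (genericDen K l α β).map (algebraMap _ _)) (fun i => by
      rw [eval_map_apply]
      exact ((map_ne_zero_iff _ (IsFractionRing.injective _ _)).2
        (eval_genericDen_ne_zero i)).isUnit)
  exact ⟨v, ⟨hv⟩⟩

/-- Evaluation at the generic point. -/
noncomputable def genericEval
    (v : (i : Fin l) → Fin (n i) → GenericField K l α β) :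
    MvPolynomial (Params n) K →ₐ[K] GenericField K l α β :=
  MvPolynomial.aeval (dataPoint (fun i => algebraMap _ (GenericField K l α β)
      (genericNode K l α β i)) v)

theorem genericNode_injective : Function.Injective
    fun i => algebraMap _ (GenericField K l α β) (genericNode K l α β i) := by
  intro i i' h
  have := MvPolynomial.X_injective (IsFractionRing.injective (GenericRing K l α β) _ h)
  exact Sum.inl_injective this

namespace IsGenericPoint

variable {v : (i : Fin l) → Fin (n i) → GenericField K l α β}

theorem degree_num_lt : ((genericNum K l α β).map (algebraMap _
    (GenericField K l α β))).degree < ((α + 1 : ℕ) : WithBot ℕ) :=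
  degree_map_le.trans_lt (degree_genericNum_lt K l α β)

theorem monic_den : ((genericDen K l α β).map (algebraMap _
    (GenericField K l α β))).Monic :=
  (genericDen_monic K l α β).map _

theorem natDegree_den : ((genericDen K l α β).map (algebraMap _
    (GenericField K l α β))).natDegree = β := by
  rw [(genericDen_monic K l α β).natDegree_map, natDegree_genericDen]

theorem signedMinor_eq_zero (hv : IsGenericPoint K α β v) {k j : ℕ} (hα : α = k - j)
    (hβ : β = ∑ i, n i + 1 - k - j) (hj : 1 ≤ j)
    (hjk : j ≤ k) (hkN : k ≤ ∑ i, n i) (hjN : k + j ≤ ∑ i, n i + 1) :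
    ∀ a ∈ Finset.Icc (k - j + 2) (k + j - 1), genericEval v (Delta K n a a) = 0 := by
  intro a ha
  rw [genericEval, aeval_Delta]
  have h := (minors_eq_zero_iff_exists_monic (v := v) genericNode_injective hα hβ hj hjk hkN hjN).2
    ⟨_, _, degree_num_lt, monic_den, natDegree_den.le, hv.interpolates⟩ a ha
  simpa [dataPoint] using h

theorem card_le_height (hv : IsGenericPoint K α β v) :
    ((l + ∑ i, n i : ℕ) : ℕ∞) ≤ (RingHom.ker (genericEval v)).height + (l + (α + 1) + β : ℕ) := by
  obtain ⟨τ, hτ, t, hc, ht⟩ := exists_generators_of_pow_dvd (K := K) genericNode_injective v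
    (fun i => le_refl (n i)) degree_num_lt monic_den hv.interpolates
  have := card_le_height_ker_add_card (genericEval v) t fun i => by
    rw [genericEval, MvPolynomial.aeval_X]
    exact ht i
  simp only [Nat.sub_self, Finset.sum_const_zero, natDegree_den, add_zero] at hc
  have hcard : Nat.card (Params n) = l + ∑ i, n i := by simp
  rw [hcard] at this
  refine this.trans ?_
  gcongr

/-- The equations hold over the field `E` of the coordinates, so a pair with coefficients in `E`
solves the problem. It is proportional to the generic pair; coprimality and monicity make the two
equal, so every parameter lies in `E`. -/
theorem adjoin_eq_top (hv : IsGenericPoint K α β v) {k j : ℕ} (hα : α = k - j)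
    (hβ : β = ∑ i, n i + 1 - k - j) (hj : 1 ≤ j)
    (hjk : j ≤ k) (hkN : k ≤ ∑ i, n i) (hjN : k + j ≤ ∑ i, n i + 1) :
    IntermediateField.adjoin K (Set.range fun i => genericEval v (MvPolynomial.X i)) = ⊤ := by
  set E := IntermediateField.adjoin K (Set.range fun i => genericEval v (MvPolynomial.X i)) with hE
  have hmem : ∀ i, genericEval v (MvPolynomial.X i) ∈ E := fun i =>
    IntermediateField.subset_adjoin K _ ⟨i, rfl⟩
  let x : Params n → E := fun i => ⟨_, hmem i⟩
  let uE : Fin l → E := fun i => x (Sum.inl i)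
  let vE : (i : Fin l) → Fin (n i) → E := fun i s => x (Sum.inr ⟨i, s⟩)
  have huF : (fun i => algebraMap E (GenericField K l α β) (uE i)) =
      fun i => algebraMap _ (GenericField K l α β) (genericNode K l α β i) := by
    funext i
    change genericEval v (MvPolynomial.X (Sum.inl i)) = _
    simp [genericEval, dataPoint]
  have hvF : (fun i s => algebraMap E (GenericField K l α β) (vE i s)) = v := by
    funext i s
    change genericEval v (MvPolynomial.X (Sum.inr ⟨i, s⟩)) = _
    simp [genericEval, dataPoint]
  have huE : Function.Injective uE := by
    have : Function.Injective fun i => algebraMap E (GenericField K l α β) (uE i) := by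
      rw [huF]; exact genericNode_injective
    exact fun i i' h => this (congrArg _ h)
  have hΔ : ∀ a ∈ Finset.Icc (k - j + 2) (k + j - 1), signedMinor uE vE a a = 0 := by
    intro a ha
    refine (map_eq_zero_iff (algebraMap E (GenericField K l α β))
      (algebraMap E (GenericField K l α β)).injective).1 ?_
    rw [map_signedMinor, huF, hvF]
    have := hv.signedMinor_eq_zero hα hβ hj hjk hkN hjN a ha
    rwa [genericEval, aeval_Delta] at this
  obtain ⟨A, B, hA, hB, hBd, hI⟩ :=
    (minors_eq_zero_iff_exists_monic huE hα hβ hj hjk hkN hjN).1 hΔ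
  have hIF := hI.map (algebraMap E (GenericField K l α β))
  rw [huF, hvF] at hIF
  set A₀ : (GenericField K l α β)[X] :=
    (genericNum K l α β).map (algebraMap _ (GenericField K l α β)) with hA₀
  set B₀ : (GenericField K l α β)[X] :=
    (genericDen K l α β).map (algebraMap _ (GenericField K l α β)) with hB₀
  have hcross : A₀ * B.map (algebraMap E (GenericField K l α β)) =
      A.map (algebraMap E (GenericField K l α β)) * B₀ := by
    have h1 : ∀ f : (GenericField K l α β)[X], f.natDegree ≤ β →
        f.degree < ((β + 1 : ℕ) : WithBot ℕ) := fun f hf =>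
      (degree_le_iff_degree_lt rfl).1 (natDegree_le_iff_degree_le.1 hf)
    exact hv.interpolates.cross_eq genericNode_injective hIF
      (degree_mul_lt_of_add_le degree_num_lt (h1 _ (natDegree_map_le.trans hBd)) (by omega))
      (degree_mul_lt_of_add_le (degree_map_le.trans_lt hA) (h1 _ natDegree_den.le) (by omega))
  have hdvd : B₀ ∣ B.map (algebraMap E (GenericField K l α β)) :=
    (isCoprime_generic (GenericField K l α β)).symm.dvd_of_dvd_mul_left
      ⟨_, hcross.trans (mul_comm _ _)⟩
  -- `B₀` divides a monic polynomial of degree at most its own.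
  have hBB : B.map (algebraMap E (GenericField K l α β)) = B₀ :=
    (eq_of_monic_of_dvd_of_natDegree_le monic_den (hB.map _) hdvd
      (by rw [natDegree_den]; exact natDegree_map_le.trans hBd))
  have hAA : A.map (algebraMap E (GenericField K l α β)) = A₀ := by
    rw [hBB] at hcross
    exact (mul_right_cancel₀ (monic_den.ne_zero) hcross).symm
  have hgen : ∀ i,
      algebraMap (GenericRing K l α β) (GenericField K l α β) (MvPolynomial.X i) ∈ E := by
    rintro (i | i | i)
    · have := congrFun huF i
      rw [genericNode] at this
      rw [← this]
      exact (uE i).2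
    · have := genericNum_coeff K l α β i
      rw [← this, ← coeff_map, ← hA₀, ← hAA, coeff_map]
      exact SetLike.coe_mem _
    · have := genericDen_coeff K l α β i
      rw [← this, ← coeff_map, ← hB₀, ← hBB, coeff_map]
      exact SetLike.coe_mem _
  have hall : ∀ s : GenericRing K l α β, algebraMap _ (GenericField K l α β) s ∈ E := by
    intro s
    induction s using MvPolynomial.induction_on with
    | C a =>
      rw [← MvPolynomial.algebraMap_eq, ← IsScalarTower.algebraMap_apply]
      exact E.algebraMap_mem a
    | add p q hp hq => rw [map_add]; exact E.add_mem hp hq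
    | mul_X p i hp => rw [map_mul]; exact E.mul_mem hp (hgen i)
  rw [eq_top_iff]
  rintro z -
  obtain ⟨a, b, -, rfl⟩ := IsFractionRing.div_surjective
    (A := GenericRing K l α β) z
  exact E.div_mem (hall a) (hall b)

end IsGenericPoint

/-- The quotient embeds in `F`, and every element of `F` is a quotient of images. -/
theorem nonempty_fractionRing_quotient_algEquiv {σ : Type*} {F : Type*} [Field F] [Algebra K F]
    (φ : MvPolynomial σ K →ₐ[K] F)
    (h : IntermediateField.adjoin K (Set.range fun i => φ (MvPolynomial.X i)) = ⊤) :
    Nonempty (FractionRing (MvPolynomial σ K ⧸ RingHom.ker φ) ≃ₐ[K] F) := by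
  let ψ : (MvPolynomial σ K ⧸ RingHom.ker φ) →ₐ[K] F := Ideal.kerLiftAlg φ
  have hψ : Function.Injective ψ := Ideal.kerLiftAlg_injective φ
  let : Algebra (MvPolynomial σ K ⧸ RingHom.ker φ) F := ψ.toRingHom.toAlgebra
  have : FaithfulSMul (MvPolynomial σ K ⧸ RingHom.ker φ) F :=
    (faithfulSMul_iff_algebraMap_injective _ _).2 hψ
  have : IsScalarTower K (MvPolynomial σ K ⧸ RingHom.ker φ) F :=
    IsScalarTower.of_algebraMap_eq fun c => (ψ.commutes c).symm
  have : IsFractionRing (MvPolynomial σ K ⧸ RingHom.ker φ) F := by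
    refine IsFractionRing.of_field _ _ fun z => ?_
    have hz : z ∈ IntermediateField.adjoin K (Set.range fun i => φ (MvPolynomial.X i)) := by
      rw [h]; trivial
    obtain ⟨r, s, rfl⟩ := (IntermediateField.mem_adjoin_range_iff K _ z).1 hz
    refine ⟨Ideal.Quotient.mk _ r, Ideal.Quotient.mk _ s, ?_⟩
    have hr : ∀ r, MvPolynomial.aeval (fun i => φ (MvPolynomial.X i)) r = φ r := fun r => by
      conv_rhs => rw [MvPolynomial.aeval_unique φ]
      rfl
    rw [hr, hr]
    rfl
  have : (RingHom.ker φ).IsPrime := RingHom.ker_isPrime _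
  exact ⟨(FractionRing.algEquiv (MvPolynomial σ K ⧸ RingHom.ker φ) F).restrictScalars K⟩

theorem nonempty_fractionRing_mvPolynomial_algEquiv (K : Type*) [Field K] (σ : Type*) [Finite σ] :
    Nonempty (FractionRing (MvPolynomial σ K) ≃ₐ[K]
      FractionRing (MvPolynomial (Fin (Nat.card σ)) K)) :=
  ⟨IsFractionRing.algEquivOfAlgEquiv
    (MvPolynomial.renameEquiv K (Finite.equivFin σ))⟩

end GenericPoint

/-! ### Irreducibility, rationality and codimension of the locus -/

section Locus

variable {K : Type*} [Field K] {l : ℕ} {n : Fin l → ℕ} {α β k j : ℕ}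

/-- The ideal of the equations cutting out the locus. -/
noncomputable def minorIdeal (K : Type*) [Field K] {l : ℕ} (n : Fin l → ℕ) (k j : ℕ) :
    Ideal (MvPolynomial (Params n) K) :=
  Ideal.span ((fun a => Delta K n a a) '' (Finset.Icc (k - j + 2) (k + j - 1) : Set ℕ))

/-- The polynomial vanishing exactly where two nodes coincide. -/
noncomputable def nodeDifferences (K : Type*) [Field K] {l : ℕ} (n : Fin l → ℕ) :
    MvPolynomial (Params n) K :=
  ∏ r ∈ (Finset.univ : Finset (Fin l)).offDiag,
    (MvPolynomial.X (Sum.inl r.1) - MvPolynomial.X (Sum.inl r.2))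

theorem aeval_nodeDifferences_ne_zero_iff {L : Type*} [Field L] [Algebra K L] (x : Params n → L) :
    MvPolynomial.aeval x (nodeDifferences K n) ≠ 0 ↔ Function.Injective fun i => x (Sum.inl i) := by
  rw [nodeDifferences, map_prod, Finset.prod_ne_zero_iff]
  constructor
  · intro h i i' hii
    by_contra hne
    refine h (i, i') (by simpa using hne) ?_
    simpa [sub_eq_zero] using hii
  · rintro h ⟨i, i'⟩ hr h0
    rw [map_sub, MvPolynomial.aeval_X, MvPolynomial.aeval_X, sub_eq_zero] at h0
    exact (Finset.mem_offDiag.1 hr).2.2 (h h0)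

/-- Krull's height theorem; the interval contains `2 (j - 1)` indices. -/
theorem height_le_of_mem_minimalPrimes (hj : 1 ≤ j) (hjk : j ≤ k)
    {q : Ideal (MvPolynomial (Params n) K)} (hq : q ∈ (minorIdeal K n k j).minimalPrimes) :
    q.height ≤ (2 * (j - 1) : ℕ) := by
  refine (Ideal.height_le_card_of_mem_minimalPrimes_span (Set.toFinite _) hq).trans ?_
  have h1 := Set.ncard_image_le (f := fun a => Delta K n a a)
    (Finset.finite_toSet (Finset.Icc (k - j + 2) (k + j - 1)))
  rw [Set.ncard_coe_finset, Nat.card_Icc] at h1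
  exact_mod_cast h1.trans (by omega)

namespace IsGenericPoint

variable {v : (i : Fin l) → Fin (n i) → GenericField K l α β}

theorem minorIdeal_le (hv : IsGenericPoint K α β v) (hα : α = k - j)
    (hβ : β = ∑ i, n i + 1 - k - j) (hj : 1 ≤ j)
    (hjk : j ≤ k) (hkN : k ≤ ∑ i, n i) (hjN : k + j ≤ ∑ i, n i + 1) :
    minorIdeal K n k j ≤ RingHom.ker (genericEval v) := by
  rw [minorIdeal, Ideal.span_le]
  rintro _ ⟨a, ha, rfl⟩
  exact hv.signedMinor_eq_zero hα hβ hj hjk hkN hjN a ha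

theorem nodeDifferences_notMem : nodeDifferences K n ∉ RingHom.ker (genericEval v) := by
  rw [RingHom.mem_ker]
  exact (aeval_nodeDifferences_ne_zero_iff _).2 genericNode_injective

/-- Every minimal prime over the equations, except those over which two nodes coincide, contains
the ideal of the generic point. -/
theorem ker_le_of_mem_minimalPrimes (hv : IsGenericPoint K α β v) (hn : ∀ i, 0 < n i)
    (hα : α = k - j)
    (hβ : β = ∑ i, n i + 1 - k - j) (hj : 1 ≤ j)
    (hjk : j ≤ k) (hkN : k ≤ ∑ i, n i) (hjN : k + j ≤ ∑ i, n i + 1)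
    {q : Ideal (MvPolynomial (Params n) K)} (hq : q ∈ (minorIdeal K n k j).minimalPrimes)
    (hd : nodeDifferences K n ∉ q) : RingHom.ker (genericEval v) ≤ q := by
  have hprime : q.IsPrime := hq.1.1
  let L := FractionRing (MvPolynomial (Params n) K ⧸ q)
  let π : MvPolynomial (Params n) K →ₐ[K] L :=
    (IsScalarTower.toAlgHom K (MvPolynomial (Params n) K ⧸ q) L).comp (Ideal.Quotient.mkₐ K q)
  have hker : ∀ f, π f = 0 ↔ f ∈ q := fun f => by
    rw [← Ideal.Quotient.eq_zero_iff_mem]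
    exact map_eq_zero_iff _ (IsFractionRing.injective (MvPolynomial (Params n) K ⧸ q) L)
  let u : Fin l → L := fun i => π (MvPolynomial.X (Sum.inl i))
  let w : (i : Fin l) → Fin (n i) → L := fun i s => π (MvPolynomial.X (Sum.inr ⟨i, s⟩))
  have hx : (fun i => π (MvPolynomial.X i)) = dataPoint u w := by
    funext i; rcases i with i | i <;> rfl
  have hπ : π = MvPolynomial.aeval (dataPoint u w) := by
    rw [← hx]; exact MvPolynomial.aeval_unique π
  have hu : Function.Injective u := by
    refine (aeval_nodeDifferences_ne_zero_iff (K := K) (dataPoint u w)).1 ?_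
    rw [← hπ, Ne, hker]
    exact hd
  have hΔ : ∀ a ∈ Finset.Icc (k - j + 2) (k + j - 1), signedMinor u w a a = 0 := by
    intro a ha
    have h1 : π (Delta K n a a) = 0 := (hker _).2 (hq.1.2 (Ideal.subset_span ⟨a, ha, rfl⟩))
    rw [hπ, aeval_Delta] at h1
    simpa [dataPoint] using h1
  obtain ⟨A, B, hA, hB, hBβ, hI⟩ :=
    (minors_eq_zero_iff_exists_monic hu hα hβ hj hjk hkN hjN).1 hΔ
  by_cases hbad : B.natDegree ≠ β ∨ ∃ i, B.eval (u i) = 0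
  -- In the degenerate case fewer than `l + (α + 1) + β` elements generate the field, so `q` would
  -- have height above `2 (j - 1)`.
  · exfalso
    obtain ⟨τ, hτ, t, hc, ht⟩ := hI.exists_generators_lt (K := K) hu hn hA hB hBβ hbad
    have h1 := card_le_height_ker_add_card π t fun i => by
      rw [hπ, MvPolynomial.aeval_X]; exact ht i
    have h2 : RingHom.ker π = q := by
      ext f; exact hker f
    have h3 := height_le_of_mem_minimalPrimes hj hjk hq
    rw [h2, show Nat.card (Params n) = l + ∑ i, n i by simp] at h1
    have h4 : l + ∑ i, n i ≤ 2 * (j - 1) + Nat.card τ := by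
      exact_mod_cast h1.trans (add_le_add_left h3 _)
    omega
  -- Here `B` has full degree and no zero at a node, so the point is a specialisation of the generic
  -- one.
  · push Not at hbad
    intro f hf
    rw [← hker, hπ]
    have hnum := map_specialize_genericNum (K := K) (β := β) u hA B
    have hden := map_specialize_genericDen (K := K) (α := α) u A hB hbad.1
    have hnode := specialize_genericNode (K := K) (α := α) (β := β) u A B
    have key := aeval_eq_zero_of_specialization (F := GenericField K l α β) (vL := w)
      (specialize (K := K) (α := α) (β := β) u A B)
      (u := genericNode K l α β) (A := genericNum K l α β) (B := genericDen K l α β)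
      (fun i => by
        rw [← AlgHom.coe_toRingHom, ← eval_map_apply]
        erw [hden]
        rw [AlgHom.coe_toRingHom, hnode]
        exact hbad.2 i) hv.interpolates (by rw [hnum, hden]; simpa only [hnode] using hI) hf
    simpa only [hnode] using key

theorem vanishingIdeal_eq [IsAlgClosed K] (hv : IsGenericPoint K α β v) (hn : ∀ i, 0 < n i)
    (hα : α = k - j)
    (hβ : β = ∑ i, n i + 1 - k - j) (hj : 1 ≤ j)
    (hjk : j ≤ k) (hkN : k ≤ ∑ i, n i) (hjN : k + j ≤ ∑ i, n i + 1) :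
    MvPolynomial.vanishingIdeal K (zerosIn (dataSpace K n)
      (Finset.Icc (k - j + 2) (k + j - 1)) fun a => Delta K n a a) =
      RingHom.ker (genericEval v) := by
  have hprime : (RingHom.ker (genericEval v)).IsPrime := RingHom.ker_isPrime _
  have hzero : ∀ x : Params n → K, x ∈ MvPolynomial.zeroLocus K (minorIdeal K n k j) ↔
      ∀ a ∈ Finset.Icc (k - j + 2) (k + j - 1), MvPolynomial.eval x (Delta K n a a) = 0 := by
    intro x
    rw [minorIdeal, MvPolynomial.zeroLocus_span]
    constructor
    · intro h a ha
      exact h _ ⟨a, ha, rfl⟩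
    · rintro h _ ⟨a, ha, rfl⟩
      exact h a ha
  -- Nullstellensatz off the diagonals: multiplying by the node differences makes `f` vanish on the
  -- excluded part as well.
  have hmem : ∀ f, f ∈ MvPolynomial.vanishingIdeal K (zerosIn (dataSpace K n)
      (Finset.Icc (k - j + 2) (k + j - 1)) fun a => Delta K n a a) ↔
      f * nodeDifferences K n ∈ (minorIdeal K n k j).radical := by
    intro f
    rw [← MvPolynomial.vanishingIdeal_zeroLocus_eq_radical (K := K)]
    constructor
    · intro h x hx
      by_cases hd : MvPolynomial.aeval x (nodeDifferences K n) = 0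
      · rw [map_mul, hd, mul_zero]
      · rw [map_mul, h x ⟨(aeval_nodeDifferences_ne_zero_iff x).1 hd, (hzero x).1 hx⟩, zero_mul]
    · rintro h x ⟨hx, hx'⟩
      have := h x ((hzero x).2 hx')
      rw [map_mul, mul_eq_zero] at this
      exact this.resolve_right ((aeval_nodeDifferences_ne_zero_iff x).2 hx)
  ext f
  rw [hmem]
  constructor
  · intro h
    have h1 := hprime.radical_le_iff.2 (hv.minorIdeal_le hα hβ hj hjk hkN hjN) h
    exact (hprime.mem_or_mem h1).resolve_right nodeDifferences_notMem
  · intro h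
    rw [← Ideal.sInf_minimalPrimes, Ideal.mem_sInf]
    intro q hq
    by_cases hd : nodeDifferences K n ∈ q
    · exact q.mul_mem_left _ hd
    · exact q.mul_mem_right _
        (hv.ker_le_of_mem_minimalPrimes hn hα hβ hj hjk hkN hjN hq hd h)

/-- A minimal prime below the kernel omits the node differences, hence contains the kernel and
equals it. Krull bounds the height above, the parameter count below. -/
theorem height_ker (hv : IsGenericPoint K α β v) (hn : ∀ i, 0 < n i) (hα : α = k - j)
    (hβ : β = ∑ i, n i + 1 - k - j) (hj : 1 ≤ j)
    (hjk : j ≤ k) (hkN : k ≤ ∑ i, n i) (hjN : k + j ≤ ∑ i, n i + 1) :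
    (RingHom.ker (genericEval v)).height = (2 * (j - 1) : ℕ) := by
  have hprime : (RingHom.ker (genericEval v)).IsPrime := RingHom.ker_isPrime _
  obtain ⟨q, hq, hle⟩ := Ideal.exists_minimalPrimes_le (hv.minorIdeal_le hα hβ hj hjk hkN hjN)
  have hge := hv.ker_le_of_mem_minimalPrimes hn hα hβ hj hjk hkN hjN hq
    fun h => nodeDifferences_notMem (hle h)
  have h1 := height_le_of_mem_minimalPrimes hj hjk hq
  have h2 := hv.card_le_height
  rw [le_antisymm hle hge] at h1
  obtain ⟨m, hm⟩ := ENat.ne_top_iff_exists.1 (ne_top_of_le_ne_top (ENat.natCast_ne_top _) h1)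
  rw [← hm] at h1 h2 ⊢
  have h3 : m ≤ 2 * (j - 1) := by exact_mod_cast h1
  have h4 : l + ∑ i, n i ≤ m + (l + (α + 1) + β) := by exact_mod_cast h2
  exact_mod_cast (by omega : m = 2 * (j - 1))

end IsGenericPoint

theorem locus_geometry [IsAlgClosed K] (hn : ∀ i, 0 < n i) (hj : 1 ≤ j)
    (hjk : j ≤ k) (hkN : k ≤ ∑ i, n i) (hjN : k + j ≤ ∑ i, n i + 1) :
    IsIrreducibleLocus (zerosIn (dataSpace K n) (Finset.Icc (k - j + 2) (k + j - 1))
        fun a => Delta K n a a) ∧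
      IsRationalLocus (zerosIn (dataSpace K n) (Finset.Icc (k - j + 2) (k + j - 1))
        fun a => Delta K n a a) ∧
      codim (zerosIn (dataSpace K n) (Finset.Icc (k - j + 2) (k + j - 1))
        fun a => Delta K n a a) = ((2 * (j - 1) : ℕ) : ℕ∞) := by
  obtain ⟨v, hv⟩ := exists_isGenericPoint K n (k - j) (∑ i, n i + 1 - k - j)
  have hI := hv.vanishingIdeal_eq hn rfl rfl hj hjk hkN hjN
  refine ⟨?_, ?_, ?_⟩
  · rw [IsIrreducibleLocus, hI]
    exact RingHom.ker_isPrime _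
  · rw [IsRationalLocus, hI]
    obtain ⟨e⟩ := nonempty_fractionRing_quotient_algEquiv (genericEval v)
      (hv.adjoin_eq_top rfl rfl hj hjk hkN hjN)
    obtain ⟨e'⟩ := nonempty_fractionRing_mvPolynomial_algEquiv K
      (GenericVars l (k - j) (∑ i, n i + 1 - k - j))
    exact ⟨_, ⟨e.trans e'⟩⟩
  · rw [codim, hI]
    exact hv.height_ker hn rfl rfl hj hjk hkN hjN

end Locus

end HermiteInterpolation

/-! ### The main theorem -/

open Polynomial HermiteInterpolation in
theorem theorem1p2 {K : Type*} [Field K] {l : ℕ} (n : Fin l → ℕ) (hn : ∀ i, 0 < n i)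
    (hchar : ringChar K = 0 ∨ ∀ i, n i ≤ ringChar K)
    (N : ℕ) (hN : N = ∑ i, n i) (k : ℕ) (hk : 1 ≤ k) (hkN : k ≤ N)
    (j : ℕ) (hj : 1 ≤ j) (hjm : j ≤ min (k - 1) (N - k) + 1) :
    (∀ (u : Fin l → K) (v : (i : Fin l) → Fin (n i) → K), Function.Injective u →
      -- the minimal solution exists and is unique up to a nonzero constant
      (∃ A B : K[X], IsMinimalSolution u v k A B ∧
        ∀ A' B' : K[X], IsMinimalSolution u v k A' B' ↔
          ∃ c : K, c ≠ 0 ∧ A' = C c * A ∧ B' = C c * B) ∧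
      -- degrees of the minimal solution and dimension of the kernel
      (∀ A B : K[X], IsMinimalSolution u v k A B →
        ((A.degree ≤ ((k - j : ℕ) : WithBot ℕ) ∧ B.degree ≤ ((N - k + 1 - j : ℕ) : WithBot ℕ)) ↔
          j ≤ Module.finrank K (LinearMap.ker (hermiteMatrix u v k (N + 1)).mulVecLin)) ∧
        (((A.degree ≤ ((k - j : ℕ) : WithBot ℕ) ∧
            B.degree ≤ ((N - k + 1 - j : ℕ) : WithBot ℕ)) ∧
            (A.degree = ((k - j : ℕ) : WithBot ℕ) ∨
              B.degree = ((N - k + 1 - j : ℕ) : WithBot ℕ))) ↔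
          Module.finrank K (LinearMap.ker (hermiteMatrix u v k (N + 1)).mulVecLin) = j)) ∧
      -- equations for both situations
      (j ≤ Module.finrank K (LinearMap.ker (hermiteMatrix u v k (N + 1)).mulVecLin) ↔
        ∀ a ∈ Finset.Icc (k - j + 2) (k + j - 1),
          MvPolynomial.eval (dataPoint u v) (Delta K n a a) = 0) ∧
      (Module.finrank K (LinearMap.ker (hermiteMatrix u v k (N + 1)).mulVecLin) = j ↔
        (∀ a ∈ Finset.Icc (k - j + 2) (k + j - 1),
          MvPolynomial.eval (dataPoint u v) (Delta K n a a) = 0) ∧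
        (MvPolynomial.eval (dataPoint u v) (Delta K n (k - j + 1) (k - j + 1)) ≠ 0 ∨
          MvPolynomial.eval (dataPoint u v) (Delta K n (k + j) (k + j)) ≠ 0)) ∧
      -- explicit minimal solutions
      ((∀ a ∈ Finset.Icc (k - j + 2) (k + j - 1),
          MvPolynomial.eval (dataPoint u v) (Delta K n a a) = 0) →
        (MvPolynomial.eval (dataPoint u v) (Delta K n (k - j + 1) (k - j + 1)) ≠ 0 →
          IsMinimalSolution u v k
            (∑ i ∈ Finset.Icc 0 (k - j),
              C (MvPolynomial.eval (dataPoint u v) (Delta K n (k - j + 1) (i + 1))) * X ^ i)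
            (∑ i ∈ Finset.Icc (k - j + 1) (N + 2 - 2 * j),
              C (MvPolynomial.eval (dataPoint u v) (Delta K n (k - j + 1) (i + 1)))
                * X ^ (i - (k - j + 1)))) ∧
        (MvPolynomial.eval (dataPoint u v) (Delta K n (k + j) (k + j)) ≠ 0 →
          IsMinimalSolution u v k
            (∑ i ∈ Finset.Icc 0 (k - j),
              C (MvPolynomial.eval (dataPoint u v) (Delta K n (k + j - 1) (i + 1))) * X ^ i)
            (∑ i ∈ Finset.Icc (k + j - 1) N,
              C (MvPolynomial.eval (dataPoint u v) (Delta K n (k + j - 1) (i + 1)))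
                * X ^ (i - (k + j - 1)))))) ∧
    -- geometry of the locus
    (IsAlgClosed K →
      IsIrreducibleLocus (zerosIn (dataSpace K n) (Finset.Icc (k - j + 2) (k + j - 1))
        fun a => Delta K n a a) ∧
      IsRationalLocus (zerosIn (dataSpace K n) (Finset.Icc (k - j + 2) (k + j - 1))
        fun a => Delta K n a a) ∧
      IsCompleteIntersection (dataSpace K n) (Finset.Icc (k - j + 2) (k + j - 1))
        (fun a => Delta K n a a) ∧
      codim (zerosIn (dataSpace K n) (Finset.Icc (k - j + 2) (k + j - 1))
        fun a => Delta K n a a) = ((2 * (j - 1) : ℕ) : ℕ∞)) := by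
  subst hN
  have hjk : j ≤ k := by omega
  have hjN : k + j ≤ ∑ i, n i + 1 := by omega
  refine ⟨fun u v hu => ?_, fun _ => ?_⟩
  · obtain ⟨g, hg⟩ := exists_isGenerator hu v hkN
    have hmin := hg.isMinimalSolution_iff hu hchar hk hkN
    have hle := hg.le_finrank_iff hu hkN hj
    have heq := hg.finrank_eq_iff hu hkN hj
    have hdeg := hg.degree_le_iff_mem_solutions hjk hkN hjN
    have hΔ := hg.mem_solutions_iff_minors hu hj hjk hjN
    have hsucc := hg.mem_solutions_succ_iff hu hj hjk hjN
    rw [← finrank_ker_hermiteMatrix u v (by omega)] at hle heq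
    simp only [eval_Delta]
    refine ⟨⟨g.1, g.2, (hmin _ _).2 ⟨1, one_ne_zero, by simp, by simp⟩, hmin⟩, ?_,
      hle.trans hΔ, ?_, fun h => ⟨fun h0 => ?_, fun h0 => ?_⟩⟩
    · intro A B hAB
      obtain ⟨c, hc, rfl, rfl⟩ := (hmin A B).1 hAB
      -- Applying `hdeg` forwards and backwards puts every membership in terms of degrees, so both
      -- equivalences share the same bounds.
      rw [degree_C_mul hc, degree_C_mul hc, hle, heq, hdeg, ← hdeg]
      exact ⟨Iff.rfl, and_congr_right fun h => hg.degree_eq_iff_notMem_solutions hkN h⟩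
    · refine heq.trans ((and_congr_right fun h => ?_).trans (and_congr_left' hΔ))
      exact (not_congr (hsucc.trans (and_iff_right h))).trans (not_and_or)
    · obtain ⟨c, hc, h1, h2⟩ := hg.exists_left_minors_eq hj hjk hjN (hΔ.2 h) h0
      exact (hmin _ _).2 ⟨c, hc, h1, h2⟩
    · obtain ⟨c, hc, h1, h2⟩ := hg.exists_right_minors_eq hj hjk hjN (hΔ.2 h) h0
      exact (hmin _ _).2 ⟨c, hc, h1, h2⟩
  · obtain ⟨h1, h2, h3⟩ := locus_geometry (K := K) hn hj hjk hkN hjN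
    refine ⟨h1, h2, ?_, h3⟩
    rw [IsCompleteIntersection, h3, Nat.card_Icc]
    congr 1
    omega
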